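/- There is an absolute constant $C>0$ with the following property. Let $n\ge 1$, let $V:\mathbb R^n\to\mathbb R$ be bounded and continuous with $V(x)>0$ for every $x\in\mathbb R^n$, and let $u_0\in L^2(\mathbb R^n)$ be real-valued with $$K_{0,h}^2:=\int_{\mathbb R^n}\frac{|u_0(x)|^2}{V(x)}\,dx<\infty .$$ Then the Cauchy problem $$u_t-\Delta u+V(x)u=0\quad (t>0,\ x\in\mathbb R^n),\qquad u(0,\cdot)=u_0,$$ where the equation is understood as an equality in $L^2(\mathbb R^n)$ for each $t>0$, has a unique real-valued solution $u\in C([0,\infty);L^2(\mathbb R^n))\cap C^1((0,\infty);L^2(\mathbb R^n))\cap C((0,\infty);H^2(\mathbb R^n))$, and this solution satisfies $$(1+t)\,\|u(t,\cdot)\|_{L^2(\mathbb R^n)}^2\le C\left(\|u_0\|_{L^2(\mathbb R^n)}^2+K_{0,h}^2\right)\qquad\text{for all } t\ge 0 .$$ -/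

import Mathlib

open MeasureTheory Set
open scoped ContDiff BoundedContinuousFunction

noncomputable section

/-- The real Hilbert space `L²(ℝⁿ)` of (classes of) real-valued functions. -/
abbrev L2 (n : ℕ) : Type := Lp ℝ 2 (volume : Measure (EuclideanSpace ℝ (Fin n)))

/-- `g` is the weak partial derivative `∂f/∂xᵢ`: `∫ f ∂ᵢφ = - ∫ g φ` for all `φ ∈ C_c^∞(ℝⁿ)`. -/
def HasWeakPartial {n : ℕ} (i : Fin n) (f g : L2 n) : Prop :=
  ∀ φ : EuclideanSpace ℝ (Fin n) → ℝ, ContDiff ℝ ∞ φ → HasCompactSupport φ →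
    ∫ x, f x * fderiv ℝ φ x (EuclideanSpace.single i 1) = -∫ x, g x * φ x

/-- Weak partial derivatives in `L²(ℝⁿ)` are unique. -/
theorem HasWeakPartial.unique {n : ℕ} {i : Fin n} {f g h : L2 n}
    (hg : HasWeakPartial i f g) (hh : HasWeakPartial i f h) : g = h := by
  have hloc (k : L2 n) : LocallyIntegrable (k : EuclideanSpace ℝ (Fin n) → ℝ) volume :=
    (Lp.memLp k).locallyIntegrable (by norm_num)
  apply Lp.ext
  apply ae_eq_of_integral_contDiff_smul_eq (hloc g) (hloc h)
  intro φ hφ hc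
  have h1 := hg φ hφ hc
  rw [hh φ hφ hc, neg_inj] at h1
  simpa only [smul_eq_mul, mul_comm] using h1.symm

open Classical in
/-- The weak partial derivative `∂f/∂xᵢ ∈ L²(ℝⁿ)` of `f` (and `0` if there is none in `L²`). -/
def weakPartial {n : ℕ} (i : Fin n) (f : L2 n) : L2 n :=
  if h : ∃ g, HasWeakPartial i f g then h.choose else 0

theorem HasWeakPartial.weakPartial_eq {n : ℕ} {i : Fin n} {f g : L2 n}
    (hg : HasWeakPartial i f g) : weakPartial i f = g := by
  have h : ∃ g, HasWeakPartial i f g := ⟨g, hg⟩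
  rw [weakPartial, dif_pos h]
  exact h.choose_spec.unique hg

/-- Membership in the Sobolev space `H²(ℝⁿ)`: all weak partial derivatives of `f` of
orders one and two exist in `L²(ℝⁿ)`. -/
def MemH2 {n : ℕ} (f : L2 n) : Prop :=
  ∀ i : Fin n, HasWeakPartial i f (weakPartial i f) ∧
    ∀ j : Fin n, HasWeakPartial j (weakPartial i f) (weakPartial j (weakPartial i f))

/-- `u ∈ C(s; H²(ℝⁿ))`: `u` takes values in `H²(ℝⁿ)` on `s`, and it is continuous on `s` for the
norm `(‖f‖² + ∑ᵢ ‖∂ᵢf‖² + ∑ᵢⱼ ‖∂ⱼ∂ᵢf‖²)^{1/2}`, that is, `u`, `∂ᵢu` and `∂ⱼ∂ᵢu` are continuous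
on `s` with values in `L²(ℝⁿ)`. -/
def ContinuousOnH2 {n : ℕ} (u : ℝ → L2 n) (s : Set ℝ) : Prop :=
  (∀ t ∈ s, MemH2 (u t)) ∧ ContinuousOn u s ∧
    (∀ i : Fin n, ContinuousOn (fun t => weakPartial i (u t)) s) ∧
    ∀ i j : Fin n, ContinuousOn (fun t => weakPartial j (weakPartial i (u t))) s

/-- The Laplacian `Δf = ∑ᵢ ∂ᵢ∂ᵢf` of `f ∈ H²(ℝⁿ)`. -/
def weakLaplacian {n : ℕ} (f : L2 n) : L2 n :=
  ∑ i : Fin n, weakPartial i (weakPartial i f)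

/-- `u ∈ C([0,∞); L²) ∩ C¹((0,∞); L²) ∩ C((0,∞); H²)` solves `u_t - Δu + V u = 0` for `t > 0`
with `u(0) = u₀`. Only the values of `u` on `[0,∞)` matter. -/
structure IsHeatSolution {n : ℕ} (V : EuclideanSpace ℝ (Fin n) →ᵇ ℝ) (u₀ : L2 n)
    (u : ℝ → L2 n) : Prop where
  continuousOn_L2 : ContinuousOn u (Ici 0)
  contDiffOn_L2 : ContDiffOn ℝ 1 u (Ioi 0)
  continuousOn_H2 : ContinuousOnH2 u (Ioi 0)
  equation : ∀ t : ℝ, 0 < t →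
    ∀ᵐ x : EuclideanSpace ℝ (Fin n), deriv u t x - weakLaplacian (u t) x + V x * u t x = 0
  initial : u 0 = u₀

end

open scoped SchwartzMap FourierTransform LineDeriv ComplexConjugate InnerProductSpace Topology
open Filter TemperedDistribution

noncomputable section

/-! Let A = -Δ + V ≥ 0 and u(t) = e^{-tA}u₀. Put z = e^{-tA}u₀ and w = e^{-tA}z. Symmetry gives ‖z‖²
= ⟨u₀, w⟩, and Young's inequality with the dual weights 1/V and V gives 2‖z‖² ≤ t⁻¹∫u₀²/V + t⟨w,
Vw⟩. Since -Δ ≥ 0, ⟨w, Vw⟩ ≤ ⟨w, Aw⟩ ≤ ‖A e^{-tA}z‖ ‖w‖ ≤ t⁻¹‖z‖², so the last term is absorbed and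
t‖z‖² ≤ ∫u₀²/V. Adding ‖z‖² ≤ ‖u₀‖² gives C = 1 for every n and V (`two_mul_re_inner_toC_le`,
`norm_heatSolution_le`).

The semigroup is built from bounded operators only. For l = 4π²c² > ‖V‖ the free resolvent R = (l -
Δ)⁻¹ is a Fourier multiplier, Q = (1 + VR)⁻¹ comes from a Neumann series, and J = RQ = (l + A)⁻¹ is
bounded, positive and injective. Then e^{-tA} is the continuous functional calculus of J at x ↦
exp(-t(x⁻¹ - l)), and scalar estimates on [0, l⁻¹] become contraction, smoothing and
differentiability. Since u(t) is the real part of R q(t) with q continuous in L², its H² regularity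
is read off the bounded symbols of ∂R and ∂∂R (`isHeatSolution_heatSolution`). The Fourier transform
and the spectral theory live over ℂ; taking real parts is harmless because V is real.

Uniqueness is an energy argument: ‖v - w‖² is nonincreasing because -Δ and V are both nonnegative
(`IsHeatSolution.eqOn`). -/

/-- The complex Hilbert space `L²(ℝⁿ; ℂ)`. -/
abbrev LC (n : ℕ) : Type := Lp ℂ 2 (volume : Measure (EuclideanSpace ℝ (Fin n)))

/-! ### Multiplication operators and Fourier multipliers on complex L². -/

section Multiplication

variable {n : ℕ}

theorem memLp_top_coe (φ : EuclideanSpace ℝ (Fin n) →ᵇ ℂ) :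
    MemLp φ ⊤ (volume : Measure (EuclideanSpace ℝ (Fin n))) := φ.memLp_top

/-- Multiplication by a bounded continuous function on `L²(ℝⁿ; ℂ)`. -/
def lpMul (φ : EuclideanSpace ℝ (Fin n) →ᵇ ℂ) : LC n →L[ℂ] LC n :=
  LinearMap.mkContinuous
    { toFun := fun f => ((memLp_top_coe φ).toLp • f : LC n)
      map_add' := fun _ _ => Lp.add_smul _ _ _
      map_smul' := fun _ _ => (Lp.smul_comm _ _ _).symm }
    ‖(memLp_top_coe φ).toLp‖ (fun _ => Lp.norm_smul_le _ _)

theorem lpMul_apply (φ : EuclideanSpace ℝ (Fin n) →ᵇ ℂ) (f : LC n) :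
    lpMul φ f = ((memLp_top_coe φ).toLp • f : LC n) := rfl

theorem coeFn_lpMul (φ : EuclideanSpace ℝ (Fin n) →ᵇ ℂ) (f : LC n) :
    lpMul φ f =ᵐ[volume] fun x => φ x * f x := by
  filter_upwards [Lp.coeFn_lpSMul (r := 2) (memLp_top_coe φ).toLp f, (memLp_top_coe φ).coeFn_toLp]
    with x h1 h2
  rw [lpMul_apply, h1, Pi.smul_apply', h2, smul_eq_mul]

theorem norm_lpMul_apply_le (φ : EuclideanSpace ℝ (Fin n) →ᵇ ℂ) (f : LC n) {C : ℝ}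
    (hC : ∀ x, ‖φ x‖ ≤ C) : ‖lpMul φ f‖ ≤ C * ‖f‖ := by
  apply Lp.norm_le_mul_norm_of_ae_le_mul
  filter_upwards [coeFn_lpMul φ f] with x hx
  rw [hx, norm_mul]
  gcongr
  exact hC x

theorem inner_lpMul_left (φ : EuclideanSpace ℝ (Fin n) →ᵇ ℂ) (f g : LC n) :
    ⟪lpMul φ f, g⟫_ℂ = ∫ x, conj (φ x) * ⟪f x, g x⟫_ℂ := by
  rw [L2.inner_def]
  refine integral_congr_ae ?_
  filter_upwards [coeFn_lpMul φ f] with x hx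
  rw [hx, ← smul_eq_mul, inner_smul_left]

theorem inner_lpMul_right (φ : EuclideanSpace ℝ (Fin n) →ᵇ ℂ) (f g : LC n) :
    ⟪f, lpMul φ g⟫_ℂ = ∫ x, φ x * ⟪f x, g x⟫_ℂ := by
  rw [L2.inner_def]
  refine integral_congr_ae ?_
  filter_upwards [coeFn_lpMul φ g] with x hx
  rw [hx, ← smul_eq_mul, inner_smul_right]

theorem inner_lpMul_symm {φ : EuclideanSpace ℝ (Fin n) →ᵇ ℂ} (hφ : ∀ x, conj (φ x) = φ x)
    (f g : LC n) : ⟪lpMul φ f, g⟫_ℂ = ⟪f, lpMul φ g⟫_ℂ := by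
  rw [inner_lpMul_left, inner_lpMul_right]
  simp only [hφ]

theorem re_inner_lpMul_self (φ : EuclideanSpace ℝ (Fin n) →ᵇ ℂ) (f : LC n) :
    (⟪f, lpMul φ f⟫_ℂ).re = ∫ x, (φ x).re * ‖f x‖ ^ 2 := by
  have hi : Integrable (fun x => ⟪f x, lpMul φ f x⟫_ℂ) volume := L2.integrable_inner f (lpMul φ f)
  rw [L2.inner_def]
  have := integral_re hi
  simp only [RCLike.re_eq_complex_re] at this
  rw [← this]
  refine integral_congr_ae ?_
  filter_upwards [coeFn_lpMul φ f] with x hx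
  rw [hx, ← smul_eq_mul, inner_smul_right, inner_self_eq_norm_sq_to_K]
  simp [← Complex.ofReal_pow]

/-- The Fourier multiplier with bounded continuous symbol `φ` on `L²(ℝⁿ; ℂ)`. -/
def fourierMul (φ : EuclideanSpace ℝ (Fin n) →ᵇ ℂ) : LC n →L[ℂ] LC n :=
  ((Lp.fourierTransformₗᵢ (EuclideanSpace ℝ (Fin n)) ℂ).symm.toContinuousLinearEquiv :
      LC n →L[ℂ] LC n) ∘L lpMul φ ∘L
    ((Lp.fourierTransformₗᵢ (EuclideanSpace ℝ (Fin n)) ℂ).toContinuousLinearEquiv :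
      LC n →L[ℂ] LC n)

theorem fourierMul_apply (φ : EuclideanSpace ℝ (Fin n) →ᵇ ℂ) (f : LC n) :
    fourierMul φ f = 𝓕⁻ (lpMul φ (𝓕 f)) := rfl

theorem fourier_fourierMul (φ : EuclideanSpace ℝ (Fin n) →ᵇ ℂ) (f : LC n) :
    𝓕 (fourierMul φ f) = lpMul φ (𝓕 f) := by
  rw [fourierMul_apply, FourierTransform.fourier_fourierInv_eq]

theorem norm_fourierMul_apply_le (φ : EuclideanSpace ℝ (Fin n) →ᵇ ℂ) (f : LC n) {C : ℝ}
    (hC : ∀ x, ‖φ x‖ ≤ C) : ‖fourierMul φ f‖ ≤ C * ‖f‖ := by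
  rw [← Lp.norm_fourier_eq, fourier_fourierMul, ← Lp.norm_fourier_eq f]
  exact norm_lpMul_apply_le φ _ hC

theorem inner_fourierMul_symm {φ : EuclideanSpace ℝ (Fin n) →ᵇ ℂ} (hφ : ∀ x, conj (φ x) = φ x)
    (f g : LC n) : ⟪fourierMul φ f, g⟫_ℂ = ⟪f, fourierMul φ g⟫_ℂ := by
  rw [← Lp.inner_fourier_eq, fourier_fourierMul, ← Lp.inner_fourier_eq f, fourier_fourierMul,
    inner_lpMul_symm hφ]

/-- Connects the bounded operator on L² with the distributional multiplier, where derivatives are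
themselves multipliers. -/
theorem toTemperedDistribution_fourierMul {φ : EuclideanSpace ℝ (Fin n) →ᵇ ℂ}
    (hφ : Function.HasTemperateGrowth φ) (f : LC n) :
    ((fourierMul φ f : LC n) : 𝓢'(EuclideanSpace ℝ (Fin n), ℂ)) =
      TemperedDistribution.fourierMultiplierCLM ℂ φ (f : 𝓢'(EuclideanSpace ℝ (Fin n), ℂ)) := by
  rw [fourierMultiplierCLM_apply, fourierMul_apply, Lp.fourier_toTemperedDistribution_eq,
    ← Lp.fourierInv_toTemperedDistribution_eq, lpMul_apply,
    Lp.toTemperedDistribution_smul_eq hφ (memLp_top_coe φ)]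

/-- Allows identities between L² functions to be proved among tempered distributions, where
unbounded symbols make sense. -/
theorem toTemperedDistribution_injective {f g : LC n}
    (h : (f : 𝓢'(EuclideanSpace ℝ (Fin n), ℂ)) = (g : 𝓢'(EuclideanSpace ℝ (Fin n), ℂ))) :
    f = g := by
  have hk := Lp.ker_toTemperedDistributionCLM_eq_bot (E := EuclideanSpace ℝ (Fin n)) (F := ℂ)
    (μ := volume) (p := 2)
  exact LinearMap.ker_eq_bot.mp hk h

end Multiplication

/-! ### Passing between real and complex L². -/

section RealPart

variable {n : ℕ}

/-- The inclusion of real-valued into complex-valued `L²` functions. -/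
def toC : L2 n →L[ℝ] LC n := Complex.ofRealCLM.compLpL 2 volume

/-- The real part of a complex-valued `L²` function. -/
def reL : LC n →L[ℝ] L2 n := Complex.reCLM.compLpL 2 volume

theorem coeFn_toC (f : L2 n) : toC f =ᵐ[volume] fun x => (f x : ℂ) :=
  Complex.ofRealCLM.coeFn_compLpL f

theorem coeFn_reL (f : LC n) : reL f =ᵐ[volume] fun x => (f x).re :=
  Complex.reCLM.coeFn_compLpL f

theorem reL_toC (f : L2 n) : reL (toC f) = f := by
  apply Lp.ext
  filter_upwards [coeFn_reL (toC f), coeFn_toC f] with x h1 h2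
  rw [h1, h2, Complex.ofReal_re]

theorem norm_toC (f : L2 n) : ‖toC f‖ = ‖f‖ := by
  apply le_antisymm <;> apply Lp.norm_le_norm_of_ae_le <;>
    filter_upwards [coeFn_toC f] with x h <;> simp [h]

theorem norm_reL_le (f : LC n) : ‖reL f‖ ≤ ‖f‖ := by
  apply Lp.norm_le_norm_of_ae_le
  filter_upwards [coeFn_reL f] with x h
  rw [h]
  exact Complex.abs_re_le_norm _

theorem inner_toC (f g : L2 n) : ⟪toC f, toC g⟫_ℂ = (⟪f, g⟫_ℝ : ℝ) := by
  rw [L2.inner_def, L2.inner_def, ← integral_complex_ofReal]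
  refine integral_congr_ae ?_
  filter_upwards [coeFn_toC f, coeFn_toC g] with x h1 h2
  simp [h1, h2]

end RealPart

/-! ### Weak derivatives and distributional derivatives. -/

section WeakDerivative

variable {n : ℕ}

theorem tendsto_inv_natCast_add_one_smul (x : EuclideanSpace ℝ (Fin n)) :
    Tendsto (fun k : ℕ => ((k : ℝ) + 1)⁻¹ • x) atTop (𝓝 0) := by
  have h : Tendsto (fun k : ℕ => ((k : ℝ) + 1)⁻¹) atTop (𝓝 0) := by
    simpa only [one_div] using tendsto_one_div_add_atTop_nhds_zero_nat (𝕜 := ℝ)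
  simpa using h.smul_const x

/-- Weak derivatives may be tested against smooth functions which are in `L²` together with the
derivative in question. -/
theorem HasWeakPartial.integral_eq_of_memLp {i : Fin n} {f g : L2 n} (h : HasWeakPartial i f g)
    {φ : EuclideanSpace ℝ (Fin n) → ℝ} (hφ : ContDiff ℝ ∞ φ) (h0 : MemLp φ 2 volume)
    (h1 : MemLp (fun x => fderiv ℝ φ x (EuclideanSpace.single i 1)) 2 volume) :
    ∫ x, f x * fderiv ℝ φ x (EuclideanSpace.single i 1) = -∫ x, g x * φ x := by
  set e : EuclideanSpace ℝ (Fin n) := EuclideanSpace.single i 1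
  let χ : ContDiffBump (0 : EuclideanSpace ℝ (Fin n)) := ⟨1, 2, one_pos, one_lt_two⟩
  have hχs : ContDiff ℝ ∞ χ := χ.contDiff
  have hχc : HasCompactSupport χ := χ.hasCompactSupport
  have hdc : Continuous fun x => fderiv ℝ χ x e :=
    (hχs.continuous_fderiv (by simp)).clm_apply continuous_const
  obtain ⟨M, hM⟩ := (hχc.fderiv_apply (𝕜 := ℝ) e).exists_bound_of_continuous hdc
  -- The cutoff is dilated by `r k` → 0: differentiating it produces a factor `r k`, so the cross
  -- term vanishes in the limit, dominated by `M * |f x * φ x|`.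
  let r : ℕ → ℝ := fun k => ((k : ℝ) + 1)⁻¹
  have hr0 : ∀ k, 0 < r k := fun k => by positivity
  have hr1 : ∀ k, r k ≤ 1 := fun k => inv_le_one_of_one_le₀ (by simp)
  let c : ℕ → EuclideanSpace ℝ (Fin n) → ℝ := fun k x => χ (r k • x)
  have hcs : ∀ k, ContDiff ℝ ∞ (c k) := fun k => hχs.comp (contDiff_const_smul (r k))
  have hcc : ∀ k, HasCompactSupport (c k) := fun k =>
    hχc.comp_homeomorph (Homeomorph.smulOfNeZero (r k) (hr0 k).ne')
  have hder : ∀ k x, fderiv ℝ (fun x => c k x * φ x) x e =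
      c k x * fderiv ℝ φ x e + r k * fderiv ℝ χ (r k • x) e * φ x := by
    intro k x
    have h2 : fderiv ℝ (c k) x e = r k * fderiv ℝ χ (r k • x) e := by
      have : HasFDerivAt (c k) ((fderiv ℝ χ (r k • x)).comp
          (r k • ContinuousLinearMap.id ℝ (EuclideanSpace ℝ (Fin n)))) x :=
        (hχs.differentiable (by simp) _).hasFDerivAt.comp x
          ((hasFDerivAt_id x).const_smul (r k))
      rw [this.fderiv]
      simp
    rw [fderiv_fun_mul ((hcs k).differentiable (by simp) x) (hφ.differentiable (by simp) x)]
    simp only [add_apply, smul_apply, smul_eq_mul, h2]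
    ring
  have key : ∀ k, ∫ x, f x * (c k x * fderiv ℝ φ x e + r k * fderiv ℝ χ (r k • x) e * φ x) =
      -∫ x, g x * (c k x * φ x) := by
    intro k
    rw [← h _ ((hcs k).mul hφ) ((hcc k).mul_right)]
    exact integral_congr_ae (Eventually.of_forall fun x => by simp only [← hder]; rfl)
  have hc1 : ∀ k x, |c k x| ≤ 1 := fun k x => by
    rw [abs_of_nonneg χ.nonneg]; exact χ.le_one
  have hclim : ∀ x, Tendsto (fun k => c k x) atTop (𝓝 1) := by
    intro x
    have h3 : (χ 0 : ℝ) = 1 := χ.one_of_mem_closedBall (by simp [χ])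
    rw [← h3]
    exact (hχs.continuous.tendsto 0).comp (tendsto_inv_natCast_add_one_smul x)
  have hdlim : ∀ x, Tendsto (fun k => r k * fderiv ℝ χ (r k • x) e) atTop (𝓝 0) := by
    intro x
    have h4 : Tendsto r atTop (𝓝 0) := by
      simpa only [r, one_div] using tendsto_one_div_add_atTop_nhds_zero_nat (𝕜 := ℝ)
    simpa using h4.mul ((hdc.tendsto 0).comp (tendsto_inv_natCast_add_one_smul x))
  have hφc := hφ.continuous
  have hφd : Continuous fun x => fderiv ℝ φ x e :=
    (hφ.continuous_fderiv (by simp)).clm_apply continuous_const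
  have i1 : Integrable (fun x => f x * fderiv ℝ φ x e) volume := (Lp.memLp f).integrable_mul h1
  have i2 : Integrable (fun x => f x * φ x) volume := (Lp.memLp f).integrable_mul h0
  have i3 : Integrable (fun x => g x * φ x) volume := (Lp.memLp g).integrable_mul h0
  have hcm : ∀ k, Continuous (c k) := fun k => (hcs k).continuous
  have hL : Tendsto (fun k => ∫ x, f x * (c k x * fderiv ℝ φ x e +
      r k * fderiv ℝ χ (r k • x) e * φ x)) atTop (𝓝 (∫ x, f x * fderiv ℝ φ x e)) := by
    refine tendsto_integral_of_dominated_convergence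
      (fun x => |f x * fderiv ℝ φ x e| + M * |f x * φ x|) ?_ (i1.abs.add (i2.abs.const_mul M))
      ?_ ?_
    · intro k
      have : Continuous fun x => c k x * fderiv ℝ φ x e + r k * fderiv ℝ χ (r k • x) e * φ x :=
        ((hcm k).mul hφd).add ((continuous_const.mul
          (hdc.comp (continuous_const_smul (r k)))).mul hφc)
      exact (Lp.aestronglyMeasurable f).mul this.aestronglyMeasurable
    · intro k
      refine Eventually.of_forall fun x => ?_
      rw [mul_add, Real.norm_eq_abs]
      refine (abs_add_le _ _).trans (add_le_add ?_ ?_)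
      · rw [show f x * (c k x * fderiv ℝ φ x e) = c k x * (f x * fderiv ℝ φ x e) by ring, abs_mul]
        exact mul_le_of_le_one_left (abs_nonneg _) (hc1 k x)
      · rw [show f x * (r k * fderiv ℝ χ (r k • x) e * φ x) =
          (r k * fderiv ℝ χ (r k • x) e) * (f x * φ x) by ring, abs_mul]
        refine mul_le_mul_of_nonneg_right ?_ (abs_nonneg _)
        rw [abs_mul, abs_of_pos (hr0 k)]
        exact (mul_le_of_le_one_left (abs_nonneg _) (hr1 k)).trans (hM _)
    · refine Eventually.of_forall fun x => ?_
      have := (((hclim x).mul_const (fderiv ℝ φ x e)).add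
        ((hdlim x).mul_const (φ x))).const_mul (f x)
      simpa using this
  have hR : Tendsto (fun k => -∫ x, g x * (c k x * φ x)) atTop (𝓝 (-∫ x, g x * φ x)) := by
    refine (tendsto_integral_of_dominated_convergence (fun x => |g x * φ x|) ?_ i3.abs
      ?_ ?_).neg
    · intro k
      exact (Lp.aestronglyMeasurable g).mul ((hcm k).mul hφc).aestronglyMeasurable
    · intro k
      refine Eventually.of_forall fun x => ?_
      rw [show g x * (c k x * φ x) = c k x * (g x * φ x) by ring, Real.norm_eq_abs, abs_mul]
      exact mul_le_of_le_one_left (abs_nonneg _) (hc1 k x)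
    · refine Eventually.of_forall fun x => ?_
      simpa using ((hclim x).mul_const (φ x)).const_mul (g x)
  simp only [key] at hL
  exact tendsto_nhds_unique hL hR

/-- A weak partial derivative in `L²` is the distributional one. -/
theorem HasWeakPartial.lineDerivOp_toTemperedDistribution {i : Fin n} {f g : L2 n}
    (h : HasWeakPartial i f g) :
    ∂_{(EuclideanSpace.single i 1 : EuclideanSpace ℝ (Fin n))}
      ((toC f : LC n) : 𝓢'(EuclideanSpace ℝ (Fin n), ℂ)) =
      ((toC g : LC n) : 𝓢'(EuclideanSpace ℝ (Fin n), ℂ)) := by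
  ext ψ
  set e : EuclideanSpace ℝ (Fin n) := EuclideanSpace.single i 1
  have hd : ∀ (L : ℂ →L[ℝ] ℝ) x, fderiv ℝ (fun x => L (ψ x)) x e = L ((∂_{e} ψ) x) := by
    intro L x
    rw [SchwartzMap.lineDerivOp_apply_eq_fderiv]
    have := (L.hasFDerivAt.comp x ψ.differentiableAt.hasFDerivAt).fderiv
    rw [Function.comp_def] at this
    rw [this]
    rfl
  -- Weak derivatives are tested against real functions only, so the real and imaginary parts of `ψ`
  -- are treated separately; `L` stands for either.
  have hL : ∀ L : ℂ →L[ℝ] ℝ, ∫ x, f x * L ((∂_{e} ψ) x) = -∫ x, g x * L (ψ x) := by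
    intro L
    have hm : MemLp (fun x => fderiv ℝ (fun x => L (ψ x)) x e) 2 volume := by
      rw [funext (hd L)]
      exact L.comp_memLp' ((∂_{e} ψ).memLp 2 volume)
    have := h.integral_eq_of_memLp (φ := fun x => L (ψ x)) (L.contDiff.comp (ψ.smooth ⊤))
      (L.comp_memLp' (ψ.memLp 2 volume)) hm
    change ∫ x, f x * fderiv ℝ (fun x => L (ψ x)) x e = _ at this
    simpa only [hd] using this
  have hI : ∀ (k : L2 n) (η : 𝓢(EuclideanSpace ℝ (Fin n), ℂ)),
      Integrable (fun x => η x • (k x : ℂ)) volume := by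
    intro k η
    exact (η.memLp 2 volume).integrable_mul ((Lp.memLp k).ofReal)
  have hpair : ∀ (k : L2 n) (η : 𝓢(EuclideanSpace ℝ (Fin n), ℂ)),
      ((toC k : LC n) : 𝓢'(EuclideanSpace ℝ (Fin n), ℂ)) η =
        ⟨∫ x, k x * Complex.reCLM (η x), ∫ x, k x * Complex.imCLM (η x)⟩ := by
    intro k η
    rw [Lp.toTemperedDistribution_apply]
    have : ∫ x, η x • toC k x = ∫ x, η x • (k x : ℂ) := by
      refine integral_congr_ae ?_
      filter_upwards [coeFn_toC k] with x hx
      rw [hx]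
    rw [this]
    apply Complex.ext
    · have := integral_re (hI k η)
      simp only [RCLike.re_eq_complex_re] at this
      rw [← this]
      simp [mul_comm]
    · have := integral_im (hI k η)
      simp only [RCLike.im_eq_complex_im] at this
      rw [← this]
      simp [mul_comm]
  rw [lineDerivOp_apply_apply, map_neg, hpair, hpair, hL, hL]
  apply Complex.ext <;> simp

/-- The real part of a distributional derivative in `L²` is a weak partial derivative. -/
theorem hasWeakPartial_reL {i : Fin n} {f g : LC n}
    (h : ∂_{(EuclideanSpace.single i 1 : EuclideanSpace ℝ (Fin n))}
      (f : 𝓢'(EuclideanSpace ℝ (Fin n), ℂ)) = (g : 𝓢'(EuclideanSpace ℝ (Fin n), ℂ))) :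
    HasWeakPartial i (reL f) (reL g) := by
  intro φ hφ hc
  set e : EuclideanSpace ℝ (Fin n) := EuclideanSpace.single i 1
  have hc' : HasCompactSupport fun x => (φ x : ℂ) := hc.comp_left (g := Complex.ofReal) rfl
  have hφ' : ContDiff ℝ ∞ fun x => (φ x : ℂ) := Complex.ofRealCLM.contDiff.comp hφ
  let ψ : 𝓢(EuclideanSpace ℝ (Fin n), ℂ) := hc'.toSchwartzMap hφ'
  have hψ : ∀ x, ψ x = (φ x : ℂ) := fun _ => rfl
  have hd : ∀ x, (∂_{e} ψ) x = (fderiv ℝ φ x e : ℂ) := by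
    intro x
    rw [SchwartzMap.lineDerivOp_apply_eq_fderiv]
    have := (Complex.ofRealCLM.hasFDerivAt.comp x
      (hφ.differentiable (by simp) x).hasFDerivAt).fderiv
    exact congrArg (fun T => T e) this
  have h1 := congrArg (fun T : 𝓢'(EuclideanSpace ℝ (Fin n), ℂ) => T ψ) h
  simp only [lineDerivOp_apply_apply, map_neg, Lp.toTemperedDistribution_apply] at h1
  have hre : ∀ (k : LC n) (η : 𝓢(EuclideanSpace ℝ (Fin n), ℂ)) (θ : EuclideanSpace ℝ (Fin n) → ℝ),
      (∀ x, η x = (θ x : ℂ)) → (∫ x, η x • k x).re = ∫ x, reL k x * θ x := by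
    intro k η θ hη
    have hi : Integrable (fun x => η x • k x) volume :=
      (η.memLp 2 volume).integrable_mul (Lp.memLp k)
    have := integral_re hi
    simp only [RCLike.re_eq_complex_re] at this
    rw [← this]
    refine integral_congr_ae ?_
    filter_upwards [coeFn_reL k] with x hx
    rw [hx, hη]
    simp [mul_comm]
  rw [← hre f _ _ hd, ← hre g _ _ hψ, ← h1]
  simp

end WeakDerivative

/-! ### Scalar estimates behind the functional calculus. -/

section ScalarFunctions

variable {l t s x : ℝ}

/-- The function `x⁻¹ * exp (-t * (x⁻¹ - l))`, extended by `0` to `x ≤ 0`. -/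
def resolventExpDiv (l t x : ℝ) : ℝ := if 0 < x then x⁻¹ * Real.exp (-t * (x⁻¹ - l)) else 0

/-- The function `exp (-t * (x⁻¹ - l))`, extended by `0` to `x ≤ 0`: it turns the resolvent
`(l + A)⁻¹` into `exp (-t * A)`. -/
def resolventExp (l t x : ℝ) : ℝ := if 0 < x then Real.exp (-t * (x⁻¹ - l)) else 0

theorem resolventExp_of_pos (hx : 0 < x) : resolventExp l t x = Real.exp (-t * (x⁻¹ - l)) :=
  if_pos hx

theorem resolventExpDiv_of_pos (hx : 0 < x) :
    resolventExpDiv l t x = x⁻¹ * Real.exp (-t * (x⁻¹ - l)) := if_pos hx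

theorem resolventExp_of_nonpos (hx : x ≤ 0) : resolventExp l t x = 0 := if_neg hx.not_gt

theorem resolventExpDiv_of_nonpos (hx : x ≤ 0) : resolventExpDiv l t x = 0 := if_neg hx.not_gt

/-- Operator form: e^{-tA} = J (l + A) e^{-tA}, so the semigroup maps into the range of J, the
domain of A. -/
theorem mul_resolventExpDiv (l t x : ℝ) : x * resolventExpDiv l t x = resolventExp l t x := by
  rcases lt_or_ge 0 x with hx | hx
  · rw [resolventExp_of_pos hx, resolventExpDiv_of_pos hx, mul_inv_cancel_left₀ hx.ne']
  · rw [resolventExp_of_nonpos hx, resolventExpDiv_of_nonpos hx, mul_zero]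

theorem resolventExpDiv_add (l s t x : ℝ) :
    resolventExpDiv l (s + t) x = resolventExpDiv l s x * resolventExp l t x := by
  rcases lt_or_ge 0 x with hx | hx
  · rw [resolventExpDiv_of_pos hx, resolventExpDiv_of_pos hx, resolventExp_of_pos hx, mul_assoc,
      ← Real.exp_add]
    ring_nf
  · rw [resolventExpDiv_of_nonpos hx, resolventExpDiv_of_nonpos hx, zero_mul]

/-- Follows from 1 + s + s²/2 ≤ eˢ at s = ay. It lets a decaying exponential absorb two powers of
the spectral variable. -/
theorem sq_mul_exp_neg_le {a y : ℝ} (ha : 0 < a) (hy : 0 ≤ y) :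
    y ^ 2 * Real.exp (-(a * y)) ≤ 2 / a ^ 2 := by
  have h := Real.quadratic_le_exp_of_nonneg (x := a * y) (by positivity)
  rw [Real.exp_neg, ← div_eq_mul_inv, div_le_div_iff₀ (Real.exp_pos _) (by positivity)]
  nlinarith [mul_nonneg ha.le hy]

/-- Only x = 0, the image of infinite energy, is delicate: there the exponential beats the factor
x⁻¹, which requires t > 0. -/
theorem continuous_resolventExpDiv (l : ℝ) (ht : 0 < t) : Continuous (resolventExpDiv l t) := by
  rw [continuous_iff_continuousAt]
  intro x
  rcases lt_trichotomy x 0 with hx | rfl | hx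
  · have h : resolventExpDiv l t =ᶠ[𝓝 x] fun _ => 0 := by
      filter_upwards [Iio_mem_nhds hx] with y hy
      exact resolventExpDiv_of_nonpos (le_of_lt hy)
    exact continuousAt_const.congr h.symm
  · have hb : ∀ y, |resolventExpDiv l t y| ≤ Real.exp (t * l) * (2 / t ^ 2) * |y| := by
      intro y
      rcases lt_or_ge 0 y with hy | hy
      · have h := sq_mul_exp_neg_le ht (inv_nonneg.2 hy.le)
        rw [resolventExpDiv_of_pos hy, abs_of_pos (by positivity), abs_of_pos hy,
          show -t * (y⁻¹ - l) = t * l + -(t * y⁻¹) by ring, Real.exp_add]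
        calc y⁻¹ * (Real.exp (t * l) * Real.exp (-(t * y⁻¹)))
            = Real.exp (t * l) * (y⁻¹ ^ 2 * Real.exp (-(t * y⁻¹))) * y := by field_simp
          _ ≤ _ := by gcongr
      · rw [resolventExpDiv_of_nonpos hy, abs_zero]
        positivity
    rw [ContinuousAt, resolventExpDiv_of_nonpos le_rfl]
    apply squeeze_zero_norm hb
    have : Continuous fun y : ℝ => Real.exp (t * l) * (2 / t ^ 2) * |y| := by fun_prop
    simpa using this.tendsto 0
  · have h : resolventExpDiv l t =ᶠ[𝓝 x] fun y => y⁻¹ * Real.exp (-t * (y⁻¹ - l)) := by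
      filter_upwards [Ioi_mem_nhds hx] with y hy
      exact resolventExpDiv_of_pos hy
    refine ContinuousAt.congr ?_ h.symm
    have := continuousAt_inv₀ hx.ne'
    fun_prop

theorem continuous_resolventExp (l : ℝ) (ht : 0 < t) : Continuous (resolventExp l t) := by
  rw [← funext (mul_resolventExpDiv l t)]
  exact continuous_id.mul (continuous_resolventExpDiv l ht)

theorem inv_sub_nonneg (hl : 0 < l) (hx : 0 < x) (hx' : x ≤ l⁻¹) : 0 ≤ x⁻¹ - l := by
  rw [sub_nonneg, le_inv_comm₀ hl hx]
  exact hx'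

theorem abs_resolventExp_le (hl : 0 < l) (ht : 0 < t) (hx' : x ≤ l⁻¹) :
    |resolventExp l t x| ≤ 1 := by
  rcases lt_or_ge 0 x with hx | hx
  · rw [resolventExp_of_pos hx, Real.abs_exp, Real.exp_le_one_iff]
    nlinarith [inv_sub_nonneg hl hx hx']
  · simp [resolventExp_of_nonpos hx]

/-- With y = x⁻¹ - l the left side is y e^{-ty}, and ty ≤ e^{ty}. This is the scalar form of the
smoothing bound ‖A e^{-tA}‖ ≤ t⁻¹. -/
theorem abs_resolventExpDiv_sub_le (hl : 0 < l) (ht : 0 < t) (hx' : x ≤ l⁻¹) :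
    |resolventExpDiv l t x - l * resolventExp l t x| ≤ t⁻¹ := by
  rcases lt_or_ge 0 x with hx | hx
  · have h := inv_sub_nonneg hl hx hx'
    rw [resolventExp_of_pos hx, resolventExpDiv_of_pos hx, ← sub_mul, abs_of_nonneg (by positivity),
      neg_mul, Real.exp_neg, ← div_eq_mul_inv, div_le_iff₀ (Real.exp_pos _), ← div_eq_inv_mul,
      le_div_iff₀ ht]
    nlinarith [Real.add_one_le_exp (t * (x⁻¹ - l))]
  · rw [resolventExp_of_nonpos hx, resolventExpDiv_of_nonpos hx]
    simp [ht.le]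

/-- With y = x⁻¹ - l one has 1 - e^{-ty} ≤ ty and xy ≤ 1. It gives continuity at time 0, with a
rate, on the range of J. -/
theorem abs_resolventExp_mul_sub_le (hl : 0 < l) (ht : 0 < t) (hx0 : 0 ≤ x) (hx' : x ≤ l⁻¹) :
    |resolventExp l t x * x - x| ≤ t := by
  rcases hx0.eq_or_lt with rfl | hx
  · simpa using ht.le
  · have h := inv_sub_nonneg hl hx hx'
    have h1 := Real.add_one_le_exp (-t * (x⁻¹ - l))
    have h2 := (abs_le.1 (abs_resolventExp_le hl ht hx')).2
    rw [resolventExp_of_pos hx] at h2 ⊢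
    have h3 : x * (x⁻¹ - l) ≤ 1 := by
      rw [mul_sub, mul_inv_cancel₀ hx.ne']
      nlinarith
    rw [abs_sub_comm, abs_of_nonneg (by nlinarith)]
    nlinarith

theorem abs_exp_sub_one_sub_le (z : ℝ) : |Real.exp z - 1 - z| ≤ z ^ 2 * Real.exp |z| := by
  have h := Complex.norm_exp_sub_sum_le_norm_mul_exp (z : ℂ) 2
  simp only [Finset.sum_range_succ, Finset.sum_range_zero] at h
  norm_num at h
  rw [← sub_sub] at h
  have h2 : Complex.exp z - 1 - z = ((Real.exp z - 1 - z : ℝ) : ℂ) := by push_cast; rfl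
  rwa [h2, Complex.norm_real, Real.norm_eq_abs] at h

/-- The second-order remainder is at most e^{-ty} (hy)² e^{|h|y}. Since |h| ≤ t/2, a factor
e^{-ty/2} survives and absorbs y², whence the constant 2/(t/2)² = 8/t². -/
theorem abs_resolventExp_taylor_le (hl : 0 < l) (ht : 0 < t) {h : ℝ} (hh : |h| ≤ t / 2)
    (hx' : x ≤ l⁻¹) :
    |resolventExp l (t + h) x - resolventExp l t x -
      h * (l * resolventExp l t x - resolventExpDiv l t x)| ≤ 8 / t ^ 2 * h ^ 2 := by
  rcases lt_or_ge 0 x with hx | hx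
  · have hy := inv_sub_nonneg hl hx hx'
    rw [resolventExp_of_pos hx, resolventExp_of_pos hx, resolventExpDiv_of_pos hx]
    set y := x⁻¹ - l with hyd
    have e1 : Real.exp (-(t + h) * y) = Real.exp (-t * y) * Real.exp (-h * y) := by
      rw [← Real.exp_add]; ring_nf
    have e2 : Real.exp (-(t + h) * y) - Real.exp (-t * y) -
        h * (l * Real.exp (-t * y) - x⁻¹ * Real.exp (-t * y)) =
        Real.exp (-t * y) * (Real.exp (-h * y) - 1 - -h * y) := by
      rw [e1, hyd]; ring
    rw [e2, abs_mul, Real.abs_exp]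
    have h1 := abs_exp_sub_one_sub_le (-h * y)
    have h2 : |-h * y| ≤ t / 2 * y := by
      rw [abs_mul, abs_neg, abs_of_nonneg hy]
      gcongr
    have h3 := sq_mul_exp_neg_le (half_pos ht) hy
    calc Real.exp (-t * y) * |Real.exp (-h * y) - 1 - -h * y|
        ≤ Real.exp (-t * y) * ((-h * y) ^ 2 * Real.exp (t / 2 * y)) := by
          gcongr
          exact h1.trans (by gcongr)
      _ = y ^ 2 * Real.exp (-(t / 2 * y)) * h ^ 2 := by
          rw [show -t * y = -(t / 2 * y) + -(t / 2 * y) by ring, Real.exp_add, Real.exp_neg]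
          field_simp
      _ ≤ 2 / (t / 2) ^ 2 * h ^ 2 := by gcongr
      _ = 8 / t ^ 2 * h ^ 2 := by ring
  · rw [resolventExp_of_nonpos hx, resolventExp_of_nonpos hx, resolventExpDiv_of_nonpos hx]
    simp only [sub_zero, mul_zero, abs_zero]
    positivity

end ScalarFunctions

/-! ### The semigroup e^{-tA} as a function of the resolvent J. -/

section Semigroup

variable {H : Type*} [NormedAddCommGroup H] [InnerProductSpace ℂ H] [CompleteSpace H]
  {J : H →L[ℂ] H} {l t s : ℝ}

/-- On this interval x⁻¹ - l ≥ 0 for x > 0, so the scalar bounds above apply throughout the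
spectrum. -/
theorem ContinuousLinearMap.IsPositive.mem_Icc_of_mem_spectrum (hJ : J.IsPositive)
    (hn : ‖J‖ ≤ l⁻¹) {x : ℝ} (hx : x ∈ spectrum ℝ J) : 0 ≤ x ∧ x ≤ l⁻¹ := by
  constructor
  · exact spectrum_nonneg_of_nonneg ((ContinuousLinearMap.nonneg_iff_isPositive J).2 hJ) hx
  · have h1 := norm_apply_le_norm_cfc (id : ℝ → ℝ) J hx continuousOn_id hJ.isSelfAdjoint
    rw [cfc_id ℝ J hJ.isSelfAdjoint] at h1
    exact (le_abs_self x).trans (h1.trans hn)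

theorem cfc_resolventExp_eq_mul (hJ : IsSelfAdjoint J) (ht : 0 < t) :
    cfc (resolventExp l t) J = J * cfc (resolventExpDiv l t) J := by
  rw [← funext (mul_resolventExpDiv l t), cfc_mul (fun x => x) (resolventExpDiv l t) J
    continuousOn_id (continuous_resolventExpDiv l ht).continuousOn, cfc_id' ℝ J hJ]

theorem cfc_resolventExpDiv_add (hs : 0 < s) (ht : 0 < t) :
    cfc (resolventExpDiv l (s + t)) J =
      cfc (resolventExpDiv l s) J * cfc (resolventExp l t) J := by
  rw [funext (resolventExpDiv_add l s t), cfc_mul _ _ J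
    (continuous_resolventExpDiv l hs).continuousOn (continuous_resolventExp l ht).continuousOn]

theorem norm_cfc_resolventExp_le (hJ : J.IsPositive) (hl : 0 < l) (hn : ‖J‖ ≤ l⁻¹) (ht : 0 < t) :
    ‖cfc (resolventExp l t) J‖ ≤ 1 :=
  norm_cfc_le zero_le_one fun _ hx =>
    abs_resolventExp_le hl ht (hJ.mem_Icc_of_mem_spectrum hn hx).2

theorem cfc_resolventExpDiv_sub (ht : 0 < t) :
    cfc (fun x => resolventExpDiv l t x - l * resolventExp l t x) J =
      cfc (resolventExpDiv l t) J - l • cfc (resolventExp l t) J := by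
  have h1 := (continuous_resolventExpDiv l ht).continuousOn (s := spectrum ℝ J)
  have h2 := (continuous_resolventExp l ht).continuousOn (s := spectrum ℝ J)
  rw [cfc_sub _ _ J h1 (h2.const_mul l), cfc_const_mul l _ J h2]

theorem norm_cfc_resolventExpDiv_sub_le (hJ : J.IsPositive) (hl : 0 < l) (hn : ‖J‖ ≤ l⁻¹)
    (ht : 0 < t) :
    ‖cfc (resolventExpDiv l t) J - l • cfc (resolventExp l t) J‖ ≤ t⁻¹ := by
  rw [← cfc_resolventExpDiv_sub ht]
  exact norm_cfc_le (inv_nonneg.2 ht.le) fun _ hx =>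
    abs_resolventExpDiv_sub_le hl ht (hJ.mem_Icc_of_mem_spectrum hn hx).2

theorem norm_cfc_resolventExp_mul_sub_le (hJ : J.IsPositive) (hl : 0 < l) (hn : ‖J‖ ≤ l⁻¹)
    (ht : 0 < t) : ‖cfc (resolventExp l t) J * J - J‖ ≤ t := by
  have h2 := (continuous_resolventExp l ht).continuousOn (s := spectrum ℝ J)
  have h : cfc (fun x => resolventExp l t x * x - x) J = cfc (resolventExp l t) J * J - J := by
    rw [cfc_sub (fun x => resolventExp l t x * x) (fun x => x) J (h2.mul continuousOn_id)
        continuousOn_id, cfc_mul _ (fun x => x) J h2 continuousOn_id, cfc_id' ℝ J hJ.isSelfAdjoint]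
  rw [← h]
  exact norm_cfc_le ht.le fun _ hx =>
    abs_resolventExp_mul_sub_le hl ht (hJ.mem_Icc_of_mem_spectrum hn hx).1
      (hJ.mem_Icc_of_mem_spectrum hn hx).2

theorem norm_cfc_resolventExp_taylor_le (hJ : J.IsPositive) (hl : 0 < l) (hn : ‖J‖ ≤ l⁻¹)
    (ht : 0 < t) {h : ℝ} (hh : |h| ≤ t / 2) :
    ‖cfc (resolventExp l (t + h)) J - cfc (resolventExp l t) J -
        h • (l • cfc (resolventExp l t) J - cfc (resolventExpDiv l t) J)‖ ≤ 8 / t ^ 2 * h ^ 2 := by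
  have hc := continuous_resolventExp l ht
  have hcd := continuous_resolventExpDiv l ht
  have hth : 0 < t + h := by linarith [(abs_le.1 hh).1]
  have hch := continuous_resolventExp l hth
  have e : cfc (fun x => resolventExp l (t + h) x - resolventExp l t x -
      h * (l * resolventExp l t x - resolventExpDiv l t x)) J =
      cfc (resolventExp l (t + h)) J - cfc (resolventExp l t) J -
        h • (l • cfc (resolventExp l t) J - cfc (resolventExpDiv l t) J) := by
    rw [cfc_sub _ _ J (by fun_prop) (by fun_prop), cfc_sub _ _ J (by fun_prop) (by fun_prop),
      cfc_const_mul _ _ J (by fun_prop), cfc_sub _ _ J (by fun_prop) (by fun_prop),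
      cfc_const_mul _ _ J (by fun_prop)]
  rw [← e]
  exact norm_cfc_le (by positivity) fun x hx =>
    abs_resolventExp_taylor_le hl ht hh (hJ.mem_Icc_of_mem_spectrum hn hx).2

theorem hasDerivAt_of_norm_taylor_le {X : Type*} [NormedAddCommGroup X] [NormedSpace ℝ X]
    {f : ℝ → X} {f' : X} {C : ℝ} (ht : 0 < t)
    (h : ∀ h : ℝ, |h| ≤ t / 2 → ‖f (t + h) - f t - h • f'‖ ≤ C * h ^ 2) : HasDerivAt f f' t := by
  rw [hasDerivAt_iff_isLittleO_nhds_zero]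
  refine Asymptotics.IsBigO.trans_isLittleO (g := fun h : ℝ => h ^ 2)
    (Asymptotics.IsBigO.of_bound C ?_) (Asymptotics.isLittleO_pow_id one_lt_two)
  filter_upwards [Metric.closedBall_mem_nhds (0 : ℝ) (half_pos ht)] with r hr
  rw [mem_closedBall_zero_iff, Real.norm_eq_abs] at hr
  rw [Real.norm_eq_abs, abs_of_nonneg (sq_nonneg r)]
  exact h r hr

/-- Splitting off the fixed factor at time t/2 reduces the claim to continuity of e^{-rA} at
positive times, already known from its differentiability in operator norm. -/
theorem continuousAt_cfc_resolventExpDiv (hJ : J.IsPositive) (hl : 0 < l) (hn : ‖J‖ ≤ l⁻¹)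
    (ht : 0 < t) : ContinuousAt (fun t => cfc (resolventExpDiv l t) J) t := by
  have h : (fun r => cfc (resolventExpDiv l r) J) =ᶠ[𝓝 t]
      fun r => cfc (resolventExpDiv l (t / 2)) J * cfc (resolventExp l (r - t / 2)) J := by
    filter_upwards [Ioi_mem_nhds (half_lt_self ht)] with r hr
    rw [← cfc_resolventExpDiv_add (half_pos ht) (sub_pos.2 hr), add_sub_cancel]
  refine ContinuousAt.congr ?_ h.symm
  refine continuousAt_const.mul ?_
  have ht2 : 0 < t - t / 2 := by linarith
  have h1 := (hasDerivAt_of_norm_taylor_le (f := fun t => cfc (resolventExp l t) J) ht2 fun h hh =>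
    norm_cfc_resolventExp_taylor_le hJ hl hn ht2 hh).continuousAt
  exact ContinuousAt.comp (f := fun r => r - t / 2) h1 (by fun_prop)

theorem tendsto_cfc_resolventExp_apply (hJ : J.IsPositive) (hl : 0 < l) (hn : ‖J‖ ≤ l⁻¹)
    (hinj : ∀ v, J v = 0 → v = 0) (v : H) :
    Tendsto (fun t => cfc (resolventExp l t) J v) (𝓝[>] 0) (𝓝 v) := by
  -- A vector orthogonal to the range of the symmetric J lies in its kernel, which is trivial.
  -- Convergence on the range then extends to all of H by contractivity.
  have hd : Dense (LinearMap.range J.toLinearMap : Set H) := by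
    rw [Submodule.dense_iff_topologicalClosure_eq_top, Submodule.topologicalClosure_eq_top_iff,
      Submodule.eq_bot_iff]
    intro w hw
    refine hinj w (inner_self_eq_zero (𝕜 := ℂ) |>.1 ?_)
    rw [hJ.isSymmetric.apply_clm]
    exact (Submodule.mem_orthogonal' _ _).1 hw _ ⟨J w, rfl⟩
  rw [Metric.tendsto_nhds]
  intro ε hε
  obtain ⟨_, ⟨z, rfl⟩, hz⟩ := hd.exists_dist_lt v (show 0 < ε / 3 by positivity)
  have hm : Iio (ε / (3 * (‖z‖ + 1))) ∈ 𝓝 (0 : ℝ) := Iio_mem_nhds (by positivity)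
  filter_upwards [self_mem_nhdsWithin, nhdsWithin_le_nhds hm] with t ht htε
  set T := cfc (resolventExp l t) J
  have h1 : ‖T (v - J z)‖ ≤ ‖v - J z‖ := by
    simpa using T.le_of_opNorm_le (norm_cfc_resolventExp_le hJ hl hn ht) (v - J z)
  have h2 : ‖T (J z) - J z‖ ≤ t * ‖z‖ :=
    (T * J - J).le_of_opNorm_le (norm_cfc_resolventExp_mul_sub_le hJ hl hn ht) z
  have h3 : t * ‖z‖ < ε / 3 := by
    have h4 : t * (3 * (‖z‖ + 1)) < ε := (lt_div_iff₀ (by positivity)).1 htε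
    have h5 : 0 < t := ht
    nlinarith
  rw [dist_eq_norm] at hz ⊢
  have e : T v - v = T (v - J z) + (T (J z) - J z) - (v - J z) := by rw [map_sub]; abel
  rw [e]
  have hz' : ‖v - J z‖ < ε / 3 := hz
  calc _ ≤ ‖T (v - J z)‖ + ‖T (J z) - J z‖ + ‖v - J z‖ :=
        (norm_sub_le _ _).trans (add_le_add_left (norm_add_le _ _) _)
    _ < ε := by linarith

/-- The operator `exp (-t * A)` for the resolvent `J = (l + A)⁻¹`. -/
def semigroup (l : ℝ) (J : H →L[ℂ] H) (t : ℝ) : H →L[ℂ] H := cfc (resolventExp l t) J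

/-- The operator `(l + A) * exp (-t * A)` for the resolvent `J = (l + A)⁻¹`. -/
def semigroupDiv (l : ℝ) (J : H →L[ℂ] H) (t : ℝ) : H →L[ℂ] H := cfc (resolventExpDiv l t) J

theorem semigroup_apply_eq (hJ : J.IsPositive) (ht : 0 < t) (v : H) :
    semigroup l J t v = J (semigroupDiv l J t v) := by
  rw [semigroup, cfc_resolventExp_eq_mul hJ.isSelfAdjoint ht]
  rfl

theorem norm_semigroup_apply_le (hJ : J.IsPositive) (hl : 0 < l) (hn : ‖J‖ ≤ l⁻¹) (ht : 0 < t)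
    (v : H) : ‖semigroup l J t v‖ ≤ ‖v‖ := by
  rw [← one_mul ‖v‖]
  exact ContinuousLinearMap.le_of_opNorm_le _ (norm_cfc_resolventExp_le hJ hl hn ht) _

theorem inner_semigroup_symm (l : ℝ) (J : H →L[ℂ] H) (t : ℝ) (v w : H) :
    ⟪semigroup l J t v, w⟫_ℂ = ⟪v, semigroup l J t w⟫_ℂ := by
  have h : IsSelfAdjoint (cfc (resolventExp l t) J) := cfc_predicate _ J
  exact ContinuousLinearMap.isSelfAdjoint_iff_isSymmetric.1 h v w

theorem norm_semigroupDiv_sub_apply_le (hJ : J.IsPositive) (hl : 0 < l) (hn : ‖J‖ ≤ l⁻¹)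
    (ht : 0 < t) (v : H) :
    ‖semigroupDiv l J t v - (l : ℂ) • semigroup l J t v‖ ≤ t⁻¹ * ‖v‖ :=
  ContinuousLinearMap.le_of_opNorm_le
    (cfc (resolventExpDiv l t) J - l • cfc (resolventExp l t) J)
    (norm_cfc_resolventExpDiv_sub_le hJ hl hn ht) v

theorem norm_semigroup_taylor_le (hJ : J.IsPositive) (hl : 0 < l) (hn : ‖J‖ ≤ l⁻¹)
    (ht : 0 < t) {h : ℝ} (hh : |h| ≤ t / 2) (v : H) :
    ‖semigroup l J (t + h) v - semigroup l J t v -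
      (h : ℂ) • ((l : ℂ) • semigroup l J t v - semigroupDiv l J t v)‖ ≤
      8 / t ^ 2 * h ^ 2 * ‖v‖ :=
  ContinuousLinearMap.le_of_opNorm_le
    (cfc (resolventExp l (t + h)) J - cfc (resolventExp l t) J -
        h • (l • cfc (resolventExp l t) J - cfc (resolventExpDiv l t) J))
    (norm_cfc_resolventExp_taylor_le hJ hl hn ht hh) v

theorem continuousAt_semigroupDiv_apply (hJ : J.IsPositive) (hl : 0 < l) (hn : ‖J‖ ≤ l⁻¹)
    (ht : 0 < t) (v : H) : ContinuousAt (fun t => semigroupDiv l J t v) t :=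
  (continuousAt_cfc_resolventExpDiv hJ hl hn ht).clm_apply continuousAt_const

theorem tendsto_semigroup_apply (hJ : J.IsPositive) (hl : 0 < l) (hn : ‖J‖ ≤ l⁻¹)
    (hinj : ∀ v, J v = 0 → v = 0) (v : H) :
    Tendsto (fun t => semigroup l J t v) (𝓝[>] 0) (𝓝 v) :=
  tendsto_cfc_resolventExp_apply hJ hl hn hinj v

end Semigroup

/-! ### The free resolvent (l - Δ)⁻¹ and its relation to H². -/

section FreeResolvent

variable {n : ℕ} {c : ℝ}

theorem lpMul_add (φ ψ : EuclideanSpace ℝ (Fin n) →ᵇ ℂ) (f : LC n) :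
    lpMul (φ + ψ) f = lpMul φ f + lpMul ψ f := by
  apply Lp.ext
  filter_upwards [coeFn_lpMul (φ + ψ) f, coeFn_lpMul φ f, coeFn_lpMul ψ f,
    Lp.coeFn_add (lpMul φ f) (lpMul ψ f)] with x h1 h2 h3 h4
  rw [h1, h4, Pi.add_apply, h2, h3, BoundedContinuousFunction.add_apply, add_mul]

theorem lpMul_zero (f : LC n) : lpMul 0 f = 0 := by
  simpa using lpMul_add 0 0 f

theorem lpMul_sum {ι : Type*} (s : Finset ι) (φ : ι → EuclideanSpace ℝ (Fin n) →ᵇ ℂ) (f : LC n) :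
    lpMul (∑ i ∈ s, φ i) f = ∑ i ∈ s, lpMul (φ i) f := by
  classical
  induction s using Finset.induction_on with
  | empty => simp [lpMul_zero]
  | insert a s ha ih => rw [Finset.sum_insert ha, Finset.sum_insert ha, lpMul_add, ih]

theorem lpMul_const_smul_sub_one (a : ℂ) (φ : EuclideanSpace ℝ (Fin n) →ᵇ ℂ) (f : LC n) :
    lpMul (a • φ - 1) f = a • lpMul φ f - f := by
  apply Lp.ext
  filter_upwards [coeFn_lpMul (a • φ - 1) f, coeFn_lpMul φ f, Lp.coeFn_smul a (lpMul φ f),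
    Lp.coeFn_sub (a • lpMul φ f) f] with x h1 h2 h3 h4
  rw [h1, h4, Pi.sub_apply, h3, Pi.smul_apply, h2]
  simp [sub_mul, mul_assoc]

/-- For a symbol φ = (l + a)⁻¹ the hypothesis says exactly a ≥ 0; integrating it against |f|² gives
the corresponding form inequality. -/
theorem mul_norm_lpMul_sq_le {φ : EuclideanSpace ℝ (Fin n) →ᵇ ℂ} {l : ℝ}
    (h : ∀ x, l * ‖φ x‖ ^ 2 ≤ (φ x).re) (f : LC n) :
    l * ‖lpMul φ f‖ ^ 2 ≤ (⟪f, lpMul φ f⟫_ℂ).re := by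
  have hs : ‖lpMul φ f‖ ^ 2 = ∫ x, ‖lpMul φ f x‖ ^ 2 := by
    have h1 : (⟪lpMul φ f, lpMul φ f⟫_ℂ).re = ‖lpMul φ f‖ ^ 2 := by
      rw [inner_self_eq_norm_sq_to_K]
      simp [← Complex.ofReal_pow]
    have h2 := integral_re (L2.integrable_inner (𝕜 := ℂ) (lpMul φ f) (lpMul φ f))
    rw [← h1, L2.inner_def, ← RCLike.re_eq_complex_re, ← h2]
    refine integral_congr_ae (Eventually.of_forall fun x => ?_)
    simp only [inner_self_eq_norm_sq_to_K]
    simp [← Complex.ofReal_pow]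
  have hf : Integrable (fun x => ‖f x‖ ^ 2) volume := (Lp.memLp f).integrable_norm_pow two_ne_zero
  have hφf : Integrable (fun x => ‖lpMul φ f x‖ ^ 2) volume :=
    (Lp.memLp (lpMul φ f)).integrable_norm_pow two_ne_zero
  rw [re_inner_lpMul_self, hs, ← integral_const_mul]
  refine integral_mono_ae (hφf.const_mul l) ?_ ?_
  · refine hf.bdd_mul (c := ‖φ‖) ?_ (Eventually.of_forall fun x => ?_)
    · exact (Complex.continuous_re.comp φ.continuous).aestronglyMeasurable
    · exact (Complex.abs_re_le_norm _).trans (φ.norm_coe_le_norm x)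
  · filter_upwards [coeFn_lpMul φ f] with x hx
    rw [hx, norm_mul, mul_pow, ← mul_assoc]
    exact mul_le_mul_of_nonneg_right (h x) (sq_nonneg _)

/-- The symbol of `(4π²c² - Δ)⁻¹`. -/
def resolventSymbol (c : ℝ) (ξ : EuclideanSpace ℝ (Fin n)) : ℝ :=
  (4 * Real.pi ^ 2 * (c ^ 2 + ‖ξ‖ ^ 2))⁻¹

/-- The symbol of `∂ᵢ`. -/
def partialSymbol (i : Fin n) (ξ : EuclideanSpace ℝ (Fin n)) : ℂ :=
  2 * Real.pi * Complex.I * (inner ℝ ξ (EuclideanSpace.single i 1) : ℝ)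

theorem resolventSymbol_nonneg (ξ : EuclideanSpace ℝ (Fin n)) : 0 ≤ resolventSymbol c ξ := by
  unfold resolventSymbol; positivity

theorem resolventSymbol_mul (hc : 1 ≤ c) (ξ : EuclideanSpace ℝ (Fin n)) :
    4 * Real.pi ^ 2 * (c ^ 2 + ‖ξ‖ ^ 2) * resolventSymbol c ξ = 1 := by
  unfold resolventSymbol
  have := Real.pi_pos
  exact mul_inv_cancel₀ (by positivity)

/-- The symbol is a multiple of (1 + |ξ|²)⁻¹ composed with the dilation ξ ↦ c⁻¹ξ. -/
theorem hasTemperateGrowth_resolventSymbol (hc : 1 ≤ c) :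
    Function.HasTemperateGrowth (resolventSymbol (n := n) c) := by
  have h : (resolventSymbol (n := n) c) = fun ξ =>
      (4 * Real.pi ^ 2 * c ^ 2)⁻¹ * ((fun ξ : EuclideanSpace ℝ (Fin n) =>
        (1 + ‖ξ‖ ^ 2) ^ (-1 : ℝ)) ∘
          (c⁻¹ • ContinuousLinearMap.id ℝ (EuclideanSpace ℝ (Fin n)))) ξ := by
    funext ξ
    have hc0 : 0 < c := by linarith
    have hp := Real.pi_pos
    simp only [resolventSymbol, Function.comp_apply, smul_apply,
      ContinuousLinearMap.coe_id', id_eq, norm_smul, norm_inv, Real.norm_eq_abs, abs_of_pos hc0]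
    rw [Real.rpow_neg_one, ← mul_inv]
    congr 1
    field_simp
  rw [h]
  exact (Function.HasTemperateGrowth.const _).mul
    ((Function.hasTemperateGrowth_one_add_norm_sq_rpow _ _).comp
      (ContinuousLinearMap.hasTemperateGrowth _))

theorem hasTemperateGrowth_ofReal_resolventSymbol (hc : 1 ≤ c) :
    Function.HasTemperateGrowth fun ξ : EuclideanSpace ℝ (Fin n) => (resolventSymbol c ξ : ℂ) :=
  Function.Complex.hasTemperateGrowth_ofReal.comp (hasTemperateGrowth_resolventSymbol hc)

theorem hasTemperateGrowth_partialSymbol (i : Fin n) :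
    Function.HasTemperateGrowth (partialSymbol i) := by
  unfold partialSymbol
  fun_prop

theorem norm_partialSymbol_le (i : Fin n) (ξ : EuclideanSpace ℝ (Fin n)) :
    ‖partialSymbol i ξ‖ ≤ 2 * Real.pi * ‖ξ‖ := by
  have h := abs_real_inner_le_norm ξ (EuclideanSpace.single i (1 : ℝ))
  rw [PiLp.norm_single, norm_one, mul_one] at h
  have hp := Real.pi_pos
  simp only [partialSymbol, norm_mul, Complex.norm_real, Complex.norm_I, Real.norm_eq_abs,
    abs_of_pos hp, Complex.norm_ofNat, mul_one]
  gcongr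

theorem norm_resolventSymbol_le (hc : 1 ≤ c) (ξ : EuclideanSpace ℝ (Fin n)) :
    ‖(resolventSymbol c ξ : ℂ)‖ ≤ (4 * Real.pi ^ 2 * c ^ 2)⁻¹ := by
  rw [Complex.norm_real, Real.norm_eq_abs, abs_of_nonneg (resolventSymbol_nonneg ξ)]
  have := Real.pi_pos
  unfold resolventSymbol
  gcongr
  nlinarith [sq_nonneg ‖ξ‖]

theorem norm_partialSymbol_mul_le (hc : 1 ≤ c) (i : Fin n) (ξ : EuclideanSpace ℝ (Fin n)) :
    ‖partialSymbol i ξ * (resolventSymbol c ξ : ℂ)‖ ≤ 1 := by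
  rw [norm_mul, Complex.norm_real, Real.norm_eq_abs, abs_of_nonneg (resolventSymbol_nonneg ξ),
    ← resolventSymbol_mul hc ξ]
  refine mul_le_mul_of_nonneg_right ((norm_partialSymbol_le i ξ).trans ?_)
    (resolventSymbol_nonneg ξ)
  nlinarith [sq_nonneg (2 * Real.pi * ‖ξ‖ - 1), Real.pi_gt_three,
    mul_le_mul hc hc zero_le_one (by linarith), mul_nonneg Real.pi_pos.le (norm_nonneg ξ),
    mul_nonneg (sq_nonneg Real.pi) (show 0 ≤ c ^ 2 - 1 by nlinarith)]

theorem norm_partialSymbol_mul_partialSymbol_mul_le (hc : 1 ≤ c) (i j : Fin n)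
    (ξ : EuclideanSpace ℝ (Fin n)) :
    ‖partialSymbol j ξ * (partialSymbol i ξ * (resolventSymbol c ξ : ℂ))‖ ≤ 1 := by
  rw [← mul_assoc, norm_mul, norm_mul, Complex.norm_real, Real.norm_eq_abs,
    abs_of_nonneg (resolventSymbol_nonneg ξ), ← resolventSymbol_mul hc ξ]
  refine mul_le_mul_of_nonneg_right ?_ (resolventSymbol_nonneg ξ)
  calc ‖partialSymbol j ξ‖ * ‖partialSymbol i ξ‖
      ≤ (2 * Real.pi * ‖ξ‖) * (2 * Real.pi * ‖ξ‖) := by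
        gcongr <;> exact norm_partialSymbol_le _ ξ
    _ ≤ _ := by nlinarith [mul_nonneg (sq_nonneg Real.pi) (sq_nonneg c)]

/-- The symbol of `(4π²c² - Δ)⁻¹` as a bounded continuous function. -/
def resolventBCF (hc : 1 ≤ c) : EuclideanSpace ℝ (Fin n) →ᵇ ℂ :=
  BoundedContinuousFunction.ofNormedAddCommGroup (fun ξ => (resolventSymbol c ξ : ℂ))
    (hasTemperateGrowth_ofReal_resolventSymbol hc).1.continuous _ (norm_resolventSymbol_le hc)

/-- The symbol of `∂ᵢ(4π²c² - Δ)⁻¹` as a bounded continuous function. -/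
def partialBCF (hc : 1 ≤ c) (i : Fin n) : EuclideanSpace ℝ (Fin n) →ᵇ ℂ :=
  BoundedContinuousFunction.ofNormedAddCommGroup
    (fun ξ => partialSymbol i ξ * (resolventSymbol c ξ : ℂ))
    ((hasTemperateGrowth_partialSymbol i).mul
      (hasTemperateGrowth_ofReal_resolventSymbol hc)).1.continuous _
    (norm_partialSymbol_mul_le hc i)

/-- The symbol of `∂ⱼ∂ᵢ(4π²c² - Δ)⁻¹` as a bounded continuous function. -/
def partialPartialBCF (hc : 1 ≤ c) (i j : Fin n) : EuclideanSpace ℝ (Fin n) →ᵇ ℂ :=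
  BoundedContinuousFunction.ofNormedAddCommGroup
    (fun ξ => partialSymbol j ξ * (partialSymbol i ξ * (resolventSymbol c ξ : ℂ)))
    ((hasTemperateGrowth_partialSymbol j).mul ((hasTemperateGrowth_partialSymbol i).mul
      (hasTemperateGrowth_ofReal_resolventSymbol hc))).1.continuous _
    (norm_partialSymbol_mul_partialSymbol_mul_le hc i j)

theorem lineDerivOp_fourierMul {φ ψ : EuclideanSpace ℝ (Fin n) →ᵇ ℂ} (i : Fin n)
    (hφ : Function.HasTemperateGrowth φ) (h : ∀ ξ, ψ ξ = partialSymbol i ξ * φ ξ) (f : LC n) :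
    ∂_{(EuclideanSpace.single i 1 : EuclideanSpace ℝ (Fin n))}
      ((fourierMul φ f : LC n) : 𝓢'(EuclideanSpace ℝ (Fin n), ℂ)) =
      ((fourierMul ψ f : LC n) : 𝓢'(EuclideanSpace ℝ (Fin n), ℂ)) := by
  have hψ : Function.HasTemperateGrowth ψ := by
    rw [show (ψ : EuclideanSpace ℝ (Fin n) → ℂ) = fun ξ => partialSymbol i ξ * φ ξ from funext h]
    exact (hasTemperateGrowth_partialSymbol i).mul hφ
  rw [TemperedDistribution.lineDeriv_eq_fourierMultiplierCLM, toTemperedDistribution_fourierMul hφ,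
    toTemperedDistribution_fourierMul hψ,
    fourierMultiplierCLM_fourierMultiplierCLM_apply hφ (by fun_prop), ← smul_apply,
    ← fourierMultiplierCLM_smul (by fun_prop)]
  congr 2
  funext ξ
  rw [h]
  simp only [partialSymbol, Pi.smul_apply, Pi.mul_apply, smul_eq_mul]
  ring

/-- The resolvent `(4π²c² - Δ)⁻¹` on `L²(ℝⁿ; ℂ)`. -/
def freeResolvent (hc : 1 ≤ c) : LC n →L[ℂ] LC n := fourierMul (resolventBCF hc)

theorem lineDerivOp_freeResolvent (hc : 1 ≤ c) (i : Fin n) (f : LC n) :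
    ∂_{(EuclideanSpace.single i 1 : EuclideanSpace ℝ (Fin n))}
      ((freeResolvent hc f : LC n) : 𝓢'(EuclideanSpace ℝ (Fin n), ℂ)) =
      ((fourierMul (partialBCF hc i) f : LC n) : 𝓢'(EuclideanSpace ℝ (Fin n), ℂ)) :=
  lineDerivOp_fourierMul i (hasTemperateGrowth_ofReal_resolventSymbol hc) (fun _ => rfl) f

theorem lineDerivOp_lineDerivOp_freeResolvent (hc : 1 ≤ c) (i j : Fin n) (f : LC n) :
    ∂_{(EuclideanSpace.single j 1 : EuclideanSpace ℝ (Fin n))}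
      ((fourierMul (partialBCF hc i) f : LC n) : 𝓢'(EuclideanSpace ℝ (Fin n), ℂ)) =
      ((fourierMul (partialPartialBCF hc i j) f : LC n) : 𝓢'(EuclideanSpace ℝ (Fin n), ℂ)) :=
  lineDerivOp_fourierMul j ((hasTemperateGrowth_partialSymbol i).mul
    (hasTemperateGrowth_ofReal_resolventSymbol hc)) (fun _ => rfl) f

theorem hasWeakPartial_freeResolvent (hc : 1 ≤ c) (i : Fin n) (f : LC n) :
    HasWeakPartial i (reL (freeResolvent hc f)) (reL (fourierMul (partialBCF hc i) f)) :=
  hasWeakPartial_reL (lineDerivOp_freeResolvent hc i f)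

theorem weakPartial_freeResolvent (hc : 1 ≤ c) (i : Fin n) (f : LC n) :
    weakPartial i (reL (freeResolvent hc f)) = reL (fourierMul (partialBCF hc i) f) :=
  (hasWeakPartial_freeResolvent hc i f).weakPartial_eq

theorem hasWeakPartial_weakPartial_freeResolvent (hc : 1 ≤ c) (i j : Fin n) (f : LC n) :
    HasWeakPartial j (weakPartial i (reL (freeResolvent hc f)))
      (reL (fourierMul (partialPartialBCF hc i j) f)) := by
  rw [weakPartial_freeResolvent]
  exact hasWeakPartial_reL (lineDerivOp_lineDerivOp_freeResolvent hc i j f)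

theorem weakPartial_weakPartial_freeResolvent (hc : 1 ≤ c) (i j : Fin n) (f : LC n) :
    weakPartial j (weakPartial i (reL (freeResolvent hc f))) =
      reL (fourierMul (partialPartialBCF hc i j) f) :=
  (hasWeakPartial_weakPartial_freeResolvent hc i j f).weakPartial_eq

theorem memH2_freeResolvent (hc : 1 ≤ c) (f : LC n) : MemH2 (reL (freeResolvent hc f)) := by
  refine fun i => ⟨?_, fun j => ?_⟩
  · rw [weakPartial_freeResolvent]
    exact hasWeakPartial_freeResolvent hc i f
  · rw [weakPartial_weakPartial_freeResolvent]
    exact hasWeakPartial_weakPartial_freeResolvent hc i j f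

theorem sum_inner_single_sq (ξ : EuclideanSpace ℝ (Fin n)) :
    ∑ i, (inner ℝ ξ (EuclideanSpace.single i (1 : ℝ))) ^ 2 = ‖ξ‖ ^ 2 := by
  simpa using (EuclideanSpace.basisFun (Fin n) ℝ).sum_sq_inner_left ξ

/-- The symbol identity behind Δ(l - Δ)⁻¹ = l(l - Δ)⁻¹ - 1. -/
theorem sum_partialPartialBCF (hc : 1 ≤ c) :
    ∑ i : Fin n, partialPartialBCF hc i i =
      ((4 * Real.pi ^ 2 * c ^ 2 : ℝ) : ℂ) • resolventBCF hc - 1 := by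
  ext ξ
  have h1 : ((∑ i : Fin n, partialPartialBCF hc i i : EuclideanSpace ℝ (Fin n) →ᵇ ℂ) ξ) =
      ∑ i : Fin n, partialSymbol i ξ * (partialSymbol i ξ * (resolventSymbol c ξ : ℂ)) := by
    rw [BoundedContinuousFunction.coe_sum, Finset.sum_apply]
    rfl
  have h2 : ∀ i : Fin n, partialSymbol i ξ * (partialSymbol i ξ * (resolventSymbol c ξ : ℂ)) =
      ((-(4 * Real.pi ^ 2 * resolventSymbol c ξ) *
        inner ℝ ξ (EuclideanSpace.single i (1 : ℝ)) ^ 2 : ℝ) : ℂ) := by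
    intro i
    simp only [partialSymbol]
    push_cast
    linear_combination (4 * (Real.pi : ℂ) ^ 2 *
      ((inner ℝ ξ (EuclideanSpace.single i 1) : ℝ) : ℂ) ^ 2 * (resolventSymbol c ξ : ℂ)) *
        Complex.I_sq
  have h3 := resolventSymbol_mul hc ξ
  have h4 : (((4 * Real.pi ^ 2 * c ^ 2 : ℝ) : ℂ) • resolventBCF hc - 1 :
      EuclideanSpace ℝ (Fin n) →ᵇ ℂ) ξ =
      ((4 * Real.pi ^ 2 * c ^ 2 * resolventSymbol c ξ - 1 : ℝ) : ℂ) := by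
    push_cast
    simp [resolventBCF]
  rw [h1, h4, Finset.sum_congr rfl fun i _ => h2 i, ← Complex.ofReal_sum, ← Finset.mul_sum,
    sum_inner_single_sq]
  congr 1
  linear_combination -h3

theorem weakLaplacian_freeResolvent (hc : 1 ≤ c) (f : LC n) :
    weakLaplacian (reL (freeResolvent hc f)) =
      reL ((4 * Real.pi ^ 2 * c ^ 2 : ℝ) • freeResolvent hc f - f) := by
  have h : ∑ i : Fin n, fourierMul (partialPartialBCF hc i i) f =
      (4 * Real.pi ^ 2 * c ^ 2 : ℝ) • freeResolvent hc f - f := by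
    apply (Lp.fourierTransformₗᵢ (EuclideanSpace ℝ (Fin n)) ℂ).injective
    have h1 : ∀ g : LC n, Lp.fourierTransformₗᵢ (EuclideanSpace ℝ (Fin n)) ℂ g = 𝓕 g :=
      fun _ => rfl
    rw [map_sum, map_sub, ← algebraMap_smul ℂ, map_smul]
    simp only [h1, freeResolvent, fourier_fourierMul]
    rw [← lpMul_sum, sum_partialPartialBCF, lpMul_const_smul_sub_one]
    rfl
  rw [← h, map_sum, weakLaplacian]
  exact Finset.sum_congr rfl fun i _ => weakPartial_weakPartial_freeResolvent hc i i f

theorem fourierMultiplierCLM_sub {g₁ g₂ : EuclideanSpace ℝ (Fin n) → ℂ}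
    (h₁ : g₁.HasTemperateGrowth) (h₂ : g₂.HasTemperateGrowth) :
    TemperedDistribution.fourierMultiplierCLM ℂ (g₁ - g₂) =
      TemperedDistribution.fourierMultiplierCLM ℂ g₁ -
        TemperedDistribution.fourierMultiplierCLM ℂ g₂ := by
  simp only [TemperedDistribution.fourierMultiplierCLM,
    TemperedDistribution.smulLeftCLM_sub h₁ h₂, ContinuousLinearMap.sub_comp,
    ContinuousLinearMap.comp_sub]

/-- Shows that every element of H² is in the range of the resolvent, as uniqueness must handle
solutions of unknown origin. The symbol |ξ|² is unbounded, so the cancellation takes place among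
tempered distributions. -/
theorem freeResolvent_of_memH2 (hc : 1 ≤ c) {w : L2 n} (hw : MemH2 w) :
    freeResolvent hc (toC ((4 * Real.pi ^ 2 * c ^ 2 : ℝ) • w - weakLaplacian w)) = toC w := by
  apply toTemperedDistribution_injective
  have hΔ : ((toC (weakLaplacian w) : LC n) : 𝓢'(EuclideanSpace ℝ (Fin n), ℂ)) =
      -(2 * Real.pi) ^ 2 • TemperedDistribution.fourierMultiplierCLM ℂ
        (fun x => Complex.ofReal (‖x‖ ^ 2)) (toC w : 𝓢'(EuclideanSpace ℝ (Fin n), ℂ)) := by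
    rw [← TemperedDistribution.laplacian_eq_fourierMultiplierCLM,
      TemperedDistribution.laplacian_eq_sum (EuclideanSpace.basisFun (Fin n) ℝ), weakLaplacian,
      map_sum, ← Lp.toTemperedDistributionCLM_apply, map_sum]
    refine Finset.sum_congr rfl fun i _ => ?_
    rw [EuclideanSpace.basisFun_apply, (hw i).1.lineDerivOp_toTemperedDistribution,
      ((hw i).2 i).lineDerivOp_toTemperedDistribution, Lp.toTemperedDistributionCLM_apply]
  have hT := hasTemperateGrowth_ofReal_resolventSymbol (n := n) hc
  rw [freeResolvent, toTemperedDistribution_fourierMul hT, map_sub, map_smul,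
    ← Lp.toTemperedDistributionCLM_apply, map_sub, ContinuousLinearMap.map_smul_of_tower,
    Lp.toTemperedDistributionCLM_apply, Lp.toTemperedDistributionCLM_apply, hΔ, map_sub,
    ContinuousLinearMap.map_smul_of_tower, ContinuousLinearMap.map_smul_of_tower]
  change (4 * Real.pi ^ 2 * c ^ 2) • TemperedDistribution.fourierMultiplierCLM ℂ
    (fun ξ : EuclideanSpace ℝ (Fin n) => (resolventSymbol c ξ : ℂ)) _ -
      _ • TemperedDistribution.fourierMultiplierCLM ℂ
    (fun ξ : EuclideanSpace ℝ (Fin n) => (resolventSymbol c ξ : ℂ)) _ = _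
  rw [fourierMultiplierCLM_fourierMultiplierCLM_apply (by fun_prop) hT,
    ← algebraMap_smul ℂ (4 * Real.pi ^ 2 * c ^ 2), ← algebraMap_smul ℂ (-(2 * Real.pi) ^ 2),
    ← smul_apply, ← smul_apply, ← fourierMultiplierCLM_smul hT, ← fourierMultiplierCLM_smul
      (Function.HasTemperateGrowth.mul (by fun_prop) hT), ← sub_apply, ← fourierMultiplierCLM_sub]
  · have h1 : (algebraMap ℝ ℂ (4 * Real.pi ^ 2 * c ^ 2) •
        (fun ξ : EuclideanSpace ℝ (Fin n) => (resolventSymbol c ξ : ℂ)) -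
        algebraMap ℝ ℂ (-(2 * Real.pi) ^ 2) • ((fun x => Complex.ofReal (‖x‖ ^ 2)) *
          fun ξ : EuclideanSpace ℝ (Fin n) => (resolventSymbol c ξ : ℂ))) = fun _ => 1 := by
      funext ξ
      simp only [Pi.sub_apply, Pi.smul_apply, Pi.mul_apply, smul_eq_mul, Complex.coe_algebraMap,
        ← Complex.ofReal_mul, ← Complex.ofReal_sub]
      rw [← Complex.ofReal_one]
      congr 1
      linear_combination resolventSymbol_mul hc ξ
    rw [h1, TemperedDistribution.fourierMultiplierCLM_const, one_smul]
    rfl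
  · exact (Function.HasTemperateGrowth.const _).mul hT
  · exact (Function.HasTemperateGrowth.const _).mul
      (Function.HasTemperateGrowth.mul (by fun_prop) hT)

theorem norm_freeResolvent_apply_le (hc : 1 ≤ c) (f : LC n) :
    ‖freeResolvent hc f‖ ≤ (4 * Real.pi ^ 2 * c ^ 2)⁻¹ * ‖f‖ :=
  norm_fourierMul_apply_le _ f (norm_resolventSymbol_le hc)

theorem inner_freeResolvent_symm (hc : 1 ≤ c) (f g : LC n) :
    ⟪freeResolvent hc f, g⟫_ℂ = ⟪f, freeResolvent hc g⟫_ℂ :=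
  inner_fourierMul_symm (fun ξ => Complex.conj_ofReal (resolventSymbol c ξ)) f g

/-- For g = (l - Δ)⁻¹f this says ⟨-Δg, g⟩ ≥ 0, without mentioning Δ. -/
theorem mul_norm_freeResolvent_sq_le (hc : 1 ≤ c) (f : LC n) :
    4 * Real.pi ^ 2 * c ^ 2 * ‖freeResolvent hc f‖ ^ 2 ≤ (⟪f, freeResolvent hc f⟫_ℂ).re := by
  rw [freeResolvent, ← Lp.norm_fourier_eq, ← Lp.inner_fourier_eq, fourier_fourierMul]
  refine mul_norm_lpMul_sq_le (fun ξ => ?_) _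
  have h1 : ‖resolventBCF hc ξ‖ = resolventSymbol c ξ := by
    change ‖(resolventSymbol c ξ : ℂ)‖ = _
    rw [Complex.norm_real, Real.norm_eq_abs, abs_of_nonneg (resolventSymbol_nonneg ξ)]
  have h2 : (resolventBCF hc ξ).re = resolventSymbol c ξ := rfl
  rw [h1, h2]
  have h3 := resolventSymbol_mul hc ξ
  have h4 := resolventSymbol_nonneg (c := c) ξ
  nlinarith [mul_nonneg (mul_nonneg (sq_nonneg Real.pi) (sq_nonneg ‖ξ‖)) h4]

theorem freeResolvent_injective (hc : 1 ≤ c) {f : LC n} (h : freeResolvent hc f = 0) : f = 0 := by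
  have h1 : lpMul (resolventBCF hc) (𝓕 f) = 0 := by
    rw [← fourier_fourierMul]
    change 𝓕 (freeResolvent hc f) = 0
    rw [h]
    exact map_zero (Lp.fourierTransformₗᵢ (EuclideanSpace ℝ (Fin n)) ℂ)
  have h2 : 𝓕 f = 0 := by
    apply Lp.ext
    have h3 := coeFn_lpMul (resolventBCF hc) (𝓕 f)
    rw [h1] at h3
    filter_upwards [h3, Lp.coeFn_zero ℂ 2 (volume : Measure (EuclideanSpace ℝ (Fin n)))]
      with x h4 h5
    rw [h5] at h4 ⊢
    refine ((mul_eq_zero.1 h4.symm).resolve_left fun h6 => ?_)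
    have h7 := resolventSymbol_mul hc x
    rw [Complex.ofReal_eq_zero.1 h6, mul_zero] at h7
    exact zero_ne_one h7
  rw [← norm_eq_zero, ← Lp.norm_fourier_eq, h2, norm_zero]

/-- The Laplacian is dissipative on `H²(ℝⁿ)`. -/
theorem inner_weakLaplacian_sub_nonpos {v w : L2 n} (hv : MemH2 v) (hw : MemH2 w) :
    ⟪weakLaplacian v - weakLaplacian w, v - w⟫_ℝ ≤ 0 := by
  set l : ℝ := 4 * Real.pi ^ 2 * 1 ^ 2
  have h1 : freeResolvent le_rfl (toC (l • (v - w) - (weakLaplacian v - weakLaplacian w))) =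
      toC (v - w) := by
    rw [map_sub toC v w, ← freeResolvent_of_memH2 le_rfl hv, ← freeResolvent_of_memH2 le_rfl hw,
      ← map_sub, ← map_sub]
    congr 2
    rw [smul_sub]
    abel
  -- Here the resolvent's value is `v - w`, so the l‖v - w‖² terms on both sides cancel and leave
  -- the Laplacian term.
  have h2 := mul_norm_freeResolvent_sq_le le_rfl
    (toC (l • (v - w) - (weakLaplacian v - weakLaplacian w)))
  rw [h1, norm_toC, inner_toC, Complex.ofReal_re, inner_sub_left, real_inner_smul_left,
    real_inner_self_eq_norm_sq] at h2
  linarith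

end FreeResolvent

/-! ### The operator A = -Δ + V: its resolvent, uniqueness, the solution and its decay. -/

section Schroedinger

variable {n : ℕ} {c : ℝ}

/-- A real bounded continuous function, regarded as complex-valued. -/
def complexBCF (V : EuclideanSpace ℝ (Fin n) →ᵇ ℝ) : EuclideanSpace ℝ (Fin n) →ᵇ ℂ :=
  BoundedContinuousFunction.ofNormedAddCommGroup (fun x => (V x : ℂ))
    (Complex.continuous_ofReal.comp V.continuous) ‖V‖
    (fun x => by rw [Complex.norm_real]; exact V.norm_coe_le_norm x)

theorem complexBCF_apply (V : EuclideanSpace ℝ (Fin n) →ᵇ ℝ) (x : EuclideanSpace ℝ (Fin n)) :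
    complexBCF V x = (V x : ℂ) := rfl

theorem norm_complexBCF_apply_le (V : EuclideanSpace ℝ (Fin n) →ᵇ ℝ)
    (x : EuclideanSpace ℝ (Fin n)) : ‖complexBCF V x‖ ≤ ‖V‖ := by
  rw [complexBCF_apply, Complex.norm_real]
  exact V.norm_coe_le_norm x

theorem coeFn_reL_lpMul_complexBCF (V : EuclideanSpace ℝ (Fin n) →ᵇ ℝ) (f : LC n) :
    reL (lpMul (complexBCF V) f) =ᵐ[volume] fun x => V x * reL f x := by
  filter_upwards [coeFn_reL (lpMul (complexBCF V) f), coeFn_lpMul (complexBCF V) f, coeFn_reL f]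
    with x h1 h2 h3
  rw [h1, h2, h3, complexBCF_apply, Complex.re_ofReal_mul]

theorem re_inner_lpMul_complexBCF (V : EuclideanSpace ℝ (Fin n) →ᵇ ℝ) (f : LC n) :
    (⟪f, lpMul (complexBCF V) f⟫_ℂ).re = ∫ x, V x * ‖f x‖ ^ 2 := by
  simp only [re_inner_lpMul_self, complexBCF_apply, Complex.ofReal_re]

theorem inner_lpMul_complexBCF_symm (V : EuclideanSpace ℝ (Fin n) →ᵇ ℝ) (f g : LC n) :
    ⟪lpMul (complexBCF V) f, g⟫_ℂ = ⟪f, lpMul (complexBCF V) g⟫_ℂ :=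
  inner_lpMul_symm (fun x => Complex.conj_ofReal (V x)) f g

/-- If `4π²c² > ‖V‖` then `1 + V (4π²c² - Δ)⁻¹` has a bounded right inverse. -/
theorem exists_rightInverse_one_add (V : EuclideanSpace ℝ (Fin n) →ᵇ ℝ) (hc : 1 ≤ c)
    (hV : ‖V‖ < 4 * Real.pi ^ 2 * c ^ 2) :
    ∃ Q : LC n →L[ℂ] LC n, ∀ f,
      Q f + lpMul (complexBCF V) (freeResolvent hc (Q f)) = f := by
  set S : LC n →L[ℂ] LC n := lpMul (complexBCF V) ∘L freeResolvent hc
  have hpos : 0 < 4 * Real.pi ^ 2 * c ^ 2 := (norm_nonneg V).trans_lt hV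
  have hS : ‖-S‖ < 1 := by
    rw [norm_neg]
    refine (S.opNorm_le_bound (M := ‖V‖ * (4 * Real.pi ^ 2 * c ^ 2)⁻¹) (by positivity)
      fun f => ?_).trans_lt ?_
    · refine (norm_lpMul_apply_le _ _ (norm_complexBCF_apply_le V)).trans ?_
      rw [mul_assoc]
      exact mul_le_mul_of_nonneg_left (norm_freeResolvent_apply_le hc f) (norm_nonneg V)
    · rwa [← div_eq_mul_inv, div_lt_one hpos]
  -- Neumann series: ‖V R‖ ≤ ‖V‖ / (4π²c²) < 1.
  obtain ⟨Q, hQ⟩ := (isUnit_one_sub_of_norm_lt_one hS).exists_right_inv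
  refine ⟨Q, fun f => ?_⟩
  have := congrArg (fun T : LC n →L[ℂ] LC n => T f) hQ
  simpa [S, sub_neg_eq_add] using this

variable {V : EuclideanSpace ℝ (Fin n) →ᵇ ℝ} {Q : LC n →L[ℂ] LC n}

theorem re_inner_lpMul_complexBCF_nonneg (hV : ∀ x, 0 < V x) (f : LC n) :
    0 ≤ (⟪f, lpMul (complexBCF V) f⟫_ℂ).re := by
  rw [re_inner_lpMul_complexBCF]
  exact integral_nonneg fun x => mul_nonneg (hV x).le (sq_nonneg _)

/-- With g = RQf one has f = Qf + Vg; pairing with g and using -Δ ≥ 0 gives the bound. In effect it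
is ⟨Ag, g⟩ ≥ ⟨Vg, g⟩, the source of the positivity of J, its norm bound and the decay estimate. -/
theorem mul_norm_freeResolvent_comp_sq_le (hc : 1 ≤ c)
    (hQ : ∀ f, Q f + lpMul (complexBCF V) (freeResolvent hc (Q f)) = f) (f : LC n) :
    4 * Real.pi ^ 2 * c ^ 2 * ‖freeResolvent hc (Q f)‖ ^ 2 +
      (⟪freeResolvent hc (Q f), lpMul (complexBCF V) (freeResolvent hc (Q f))⟫_ℂ).re ≤
      (⟪f, freeResolvent hc (Q f)⟫_ℂ).re := by
  have h : ⟪f, freeResolvent hc (Q f)⟫_ℂ = ⟪Q f, freeResolvent hc (Q f)⟫_ℂ +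
      ⟪freeResolvent hc (Q f), lpMul (complexBCF V) (freeResolvent hc (Q f))⟫_ℂ := by
    rw [← inner_lpMul_complexBCF_symm, ← inner_add_left, hQ]
  rw [h, Complex.add_re]
  exact add_le_add_left (mul_norm_freeResolvent_sq_le hc (Q f)) _

theorem isPositive_freeResolvent_comp (hc : 1 ≤ c) (hV : ∀ x, 0 < V x)
    (hQ : ∀ f, Q f + lpMul (complexBCF V) (freeResolvent hc (Q f)) = f) :
    (freeResolvent hc ∘L Q).IsPositive := by
  refine ⟨fun f g => ?_, fun f => ?_⟩
  · change ⟪freeResolvent hc (Q f), g⟫_ℂ = ⟪f, freeResolvent hc (Q g)⟫_ℂ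
    -- Writing each free vector as Q + VRQ of itself turns both sides into the same expression in Qf
    -- and Qg, since R and V are symmetric.
    conv_lhs => rw [← hQ g]
    conv_rhs => rw [← hQ f]
    rw [inner_add_right, inner_add_left, inner_freeResolvent_symm, inner_lpMul_complexBCF_symm]
  · rw [ContinuousLinearMap.reApplyInnerSelf_apply, ← inner_re_symm]
    change 0 ≤ (⟪f, freeResolvent hc (Q f)⟫_ℂ).re
    refine le_trans ?_ (mul_norm_freeResolvent_comp_sq_le hc hQ f)
    have := re_inner_lpMul_complexBCF_nonneg hV (freeResolvent hc (Q f))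
    positivity

theorem norm_freeResolvent_comp_le (hc : 1 ≤ c) (hV : ∀ x, 0 < V x)
    (hQ : ∀ f, Q f + lpMul (complexBCF V) (freeResolvent hc (Q f)) = f) :
    ‖freeResolvent hc ∘L Q‖ ≤ (4 * Real.pi ^ 2 * c ^ 2)⁻¹ := by
  have hp := Real.pi_pos
  refine ContinuousLinearMap.opNorm_le_bound _ (by positivity) fun f => ?_
  change ‖freeResolvent hc (Q f)‖ ≤ _
  have h1 := mul_norm_freeResolvent_comp_sq_le hc hQ f
  have h2 := re_inner_lpMul_complexBCF_nonneg hV (freeResolvent hc (Q f))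
  have h3 : (⟪f, freeResolvent hc (Q f)⟫_ℂ).re ≤ ‖f‖ * ‖freeResolvent hc (Q f)‖ :=
    re_inner_le_norm (𝕜 := ℂ) f _
  rw [← div_eq_inv_mul, le_div_iff₀ (by positivity)]
  rcases (norm_nonneg (freeResolvent hc (Q f))).eq_or_lt with h0 | h0
  · rw [← h0, zero_mul]; exact norm_nonneg f
  · refine le_of_mul_le_mul_right ?_ h0
    linarith

theorem freeResolvent_comp_injective (hc : 1 ≤ c)
    (hQ : ∀ f, Q f + lpMul (complexBCF V) (freeResolvent hc (Q f)) = f) (f : LC n)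
    (h : (freeResolvent hc ∘L Q) f = 0) : f = 0 := by
  have h1 : freeResolvent hc (Q f) = 0 := h
  rw [← hQ f, h1, freeResolvent_injective hc h1, map_zero, add_zero]

/-- Duality between the weights `1 / V` and `V`. -/
theorem two_mul_re_inner_toC_le (hV : ∀ x, 0 < V x) {u₀ : L2 n}
    (hu : Integrable (fun x => (u₀ x) ^ 2 / V x) volume) (w : LC n) {t : ℝ} (ht : 0 < t) :
    2 * (⟪toC u₀, w⟫_ℂ).re ≤ t⁻¹ * (∫ x, (u₀ x) ^ 2 / V x) +
      t * (⟪w, lpMul (complexBCF V) w⟫_ℂ).re := by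
  have hi := L2.integrable_inner (𝕜 := ℂ) (toC u₀) w
  have hw : Integrable (fun x => ‖w x‖ ^ 2) volume := (Lp.memLp w).integrable_norm_pow two_ne_zero
  have hVw : Integrable (fun x => V x * ‖w x‖ ^ 2) volume :=
    hw.bdd_mul (c := ‖V‖) V.continuous.aestronglyMeasurable
      (Eventually.of_forall V.norm_coe_le_norm)
  have h1 := integral_re hi
  rw [re_inner_lpMul_complexBCF, L2.inner_def, ← RCLike.re_eq_complex_re, ← h1,
    ← integral_const_mul, ← integral_const_mul, ← integral_const_mul,
    ← integral_add (hu.const_mul _) (hVw.const_mul _)]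
  refine integral_mono_ae (hi.re.const_mul 2) ((hu.const_mul _).add (hVw.const_mul _)) ?_
  filter_upwards [coeFn_toC u₀] with x hx
  have h2 : RCLike.re ⟪toC u₀ x, w x⟫_ℂ ≤ |u₀ x| * ‖w x‖ := by
    rw [hx]
    refine (re_inner_le_norm _ _).trans ?_
    rw [Complex.norm_real, Real.norm_eq_abs]
  have h3 : 2 * (|u₀ x| * ‖w x‖) ≤ t⁻¹ * (u₀ x ^ 2 / V x) + t * (V x * ‖w x‖ ^ 2) := by
    have h4 := hV x
    rw [← sq_abs (u₀ x), ← sub_nonneg]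
    -- Completing the square in the weighted Young inequality.
    have h5 : t⁻¹ * (|u₀ x| ^ 2 / V x) + t * (V x * ‖w x‖ ^ 2) - 2 * (|u₀ x| * ‖w x‖) =
        (t * V x)⁻¹ * (|u₀ x| - t * V x * ‖w x‖) ^ 2 := by
      field_simp
      ring
    rw [h5]
    positivity
  exact (mul_le_mul_of_nonneg_left h2 zero_le_two).trans h3

/-- Solutions of the Cauchy problem are unique. -/
theorem IsHeatSolution.eqOn (hV : ∀ x, 0 < V x) {u₀ : L2 n} {v w : ℝ → L2 n}
    (hv : IsHeatSolution V u₀ v) (hw : IsHeatSolution V u₀ w) : EqOn v w (Ici 0) := by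
  have hdiff : ∀ {u : ℝ → L2 n}, IsHeatSolution V u₀ u → ∀ t, 0 < t →
      HasDerivAt u (deriv u t) t := fun hu t ht =>
    ((hu.contDiffOn_L2.differentiableOn one_ne_zero t ht).differentiableAt
      (Ioi_mem_nhds ht)).hasDerivAt
  have hder : ∀ t, 0 < t → HasDerivAt (fun t => ‖v t - w t‖ ^ 2)
      (2 * ⟪v t - w t, deriv v t - deriv w t⟫_ℝ) t := fun t ht =>
    ((hdiff hv t ht).sub (hdiff hw t ht)).norm_sq
  have hanti : AntitoneOn (fun t => ‖v t - w t‖ ^ 2) (Ici 0) := by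
    refine antitoneOn_of_deriv_nonpos (convex_Ici 0)
      ((hv.continuousOn_L2.sub hw.continuousOn_L2).norm.pow 2) ?_ ?_
    · rw [interior_Ici]
      exact fun t ht => (hder t ht).differentiableAt.differentiableWithinAt
    · rw [interior_Ici]
      intro t ht
      rw [(hder t ht).deriv]
      set L : L2 n := weakLaplacian (v t) - weakLaplacian (w t)
      have h1 : ⟪L, v t - w t⟫_ℝ ≤ 0 :=
        inner_weakLaplacian_sub_nonpos (hv.continuousOn_H2.1 t ht) (hw.continuousOn_H2.1 t ht)
      -- By the two equations, the second factor is V (v - w).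
      have h2 : 0 ≤ ⟪v t - w t, L - (deriv v t - deriv w t)⟫_ℝ := by
        rw [L2.inner_def]
        refine integral_nonneg_of_ae ?_
        filter_upwards [hv.equation t ht, hw.equation t ht, Lp.coeFn_sub (v t) (w t),
          Lp.coeFn_sub L (deriv v t - deriv w t), Lp.coeFn_sub (deriv v t) (deriv w t),
          Lp.coeFn_sub (weakLaplacian (v t)) (weakLaplacian (w t))] with x e1 e2 e3 e4 e5 e6
        rw [e3, e4, Pi.sub_apply, Pi.sub_apply, e5, e6, Pi.sub_apply, Pi.sub_apply]
        have e7 : weakLaplacian (v t) x - weakLaplacian (w t) x - (deriv v t x - deriv w t x) =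
            V x * (v t x - w t x) := by linear_combination e2 - e1
        rw [e7]
        simp only [Pi.zero_apply, RCLike.inner_apply, conj_trivial]
        nlinarith [mul_nonneg (hV x).le (mul_self_nonneg (v t x - w t x))]
      rw [inner_sub_right, real_inner_comm] at h2
      linarith
  intro t ht
  have h := hanti self_mem_Ici ht ht
  simp only [hv.initial, hw.initial, sub_self, norm_zero] at h
  rw [← sub_eq_zero, ← norm_eq_zero]
  nlinarith [norm_nonneg (v t - w t)]

/-- The solution of the heat equation with potential, from a resolvent of `-Δ + V`. -/
def heatSolution (l : ℝ) (J : LC n →L[ℂ] LC n) (u₀ : L2 n) (t : ℝ) : L2 n :=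
  if t ≤ 0 then u₀ else reL (semigroup l J t (toC u₀))

theorem heatSolution_of_pos {l : ℝ} {J : LC n →L[ℂ] LC n} {u₀ : L2 n} {t : ℝ} (ht : 0 < t) :
    heatSolution l J u₀ t = reL (semigroup l J t (toC u₀)) := if_neg ht.not_ge

theorem heatSolution_zero {l : ℝ} {J : LC n →L[ℂ] LC n} {u₀ : L2 n} :
    heatSolution l J u₀ 0 = u₀ := if_pos le_rfl

/-- Everything is expressed through q(t) = Q(l + A)e^{-tA}u₀, continuous in L² for t > 0. Before
real parts are taken, u = Rq, its spatial derivatives are bounded multipliers of q, and u_t = lu -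
(l + A)u with (l + A)u = q + VRq; the equation follows from ΔRq = lRq - q. -/
theorem isHeatSolution_heatSolution (hc : 1 ≤ c) (hV : ∀ x, 0 < V x)
    (hQ : ∀ f, Q f + lpMul (complexBCF V) (freeResolvent hc (Q f)) = f) (u₀ : L2 n) :
    IsHeatSolution V u₀ (heatSolution (4 * Real.pi ^ 2 * c ^ 2) (freeResolvent hc ∘L Q) u₀) := by
  set l : ℝ := 4 * Real.pi ^ 2 * c ^ 2
  set J : LC n →L[ℂ] LC n := freeResolvent hc ∘L Q
  have hp := Real.pi_pos
  have hl : 0 < l := by positivity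
  have hJ : J.IsPositive := isPositive_freeResolvent_comp hc hV hQ
  have hn : ‖J‖ ≤ l⁻¹ := norm_freeResolvent_comp_le hc hV hQ
  let q : ℝ → LC n := fun t => Q (semigroupDiv l J t (toC u₀))
  have hu : ∀ t, 0 < t → heatSolution l J u₀ t = reL (freeResolvent hc (q t)) := by
    intro t ht
    rw [heatSolution_of_pos ht, semigroup_apply_eq hJ ht]
    rfl
  have hq : ContinuousOn q (Ioi 0) := fun t ht =>
    (Q.continuous.continuousAt.comp
      (continuousAt_semigroupDiv_apply hJ hl hn ht (toC u₀))).continuousWithinAt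
  have hqc : ∀ (T : LC n →L[ℂ] LC n), ContinuousOn (fun t => reL (T (q t))) (Ioi 0) :=
    fun T => reL.continuous.comp_continuousOn (T.continuous.comp_continuousOn hq)
  have hev : ∀ t, 0 < t → heatSolution l J u₀ =ᶠ[𝓝 t]
      fun t => reL (semigroup l J t (toC u₀)) := by
    intro t ht
    filter_upwards [Ioi_mem_nhds ht] with r hr
    exact heatSolution_of_pos hr
  have hder : ∀ t, 0 < t → HasDerivAt (heatSolution l J u₀)
      (reL (l • freeResolvent hc (q t) - (q t + lpMul (complexBCF V) (freeResolvent hc (q t)))))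
      t := by
    intro t ht
    refine HasDerivAt.congr_of_eventuallyEq ?_ (hev t ht)
    have h2 : HasDerivAt (fun r => semigroup l J r (toC u₀))
        (l • semigroup l J t (toC u₀) - semigroupDiv l J t (toC u₀)) t := by
      refine hasDerivAt_of_norm_taylor_le (C := 8 / t ^ 2 * ‖toC u₀‖) ht fun h hh => ?_
      have h1 := norm_semigroup_taylor_le hJ hl hn ht hh (toC u₀)
      rw [← algebraMap_smul ℂ h, ← algebraMap_smul ℂ l, mul_right_comm]
      exact h1
    have h3 := reL.hasFDerivAt.comp_hasDerivAt t h2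
    rw [semigroup_apply_eq hJ ht] at h3
    rw [hQ]
    exact h3
  have hcd : ContinuousOn (fun t => reL (l • freeResolvent hc (q t) -
      (q t + lpMul (complexBCF V) (freeResolvent hc (q t))))) (Ioi 0) := by
    have h := (freeResolvent hc).continuous.comp_continuousOn hq
    exact reL.continuous.comp_continuousOn ((h.const_smul l).sub
      (hq.add ((lpMul (complexBCF V)).continuous.comp_continuousOn h)))
  refine ⟨?_, ?_, ⟨?_, ?_, ?_, ?_⟩, ?_, heatSolution_zero⟩
  · intro t ht
    rcases (mem_Ici.1 ht).eq_or_lt with rfl | ht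
    -- At t = 0 the value is set to u₀ by hand, so continuity is the strong convergence e^{-tA} → 1,
    -- for which J must be injective.
    · rw [← continuousWithinAt_Ioi_iff_Ici, ContinuousWithinAt, heatSolution_zero]
      have h1 := tendsto_semigroup_apply hJ hl hn (freeResolvent_comp_injective hc hQ)
        (toC u₀)
      have h2 := (reL.continuous.tendsto (toC u₀)).comp h1
      rw [reL_toC] at h2
      refine h2.congr' ?_
      filter_upwards [self_mem_nhdsWithin] with r hr
      exact (heatSolution_of_pos hr).symm
    · exact (hder t ht).continuousAt.continuousWithinAt
  · rw [show (1 : WithTop ℕ∞) = 0 + 1 from rfl, contDiffOn_succ_iff_deriv_of_isOpen isOpen_Ioi]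
    refine ⟨fun t ht => (hder t ht).differentiableAt.differentiableWithinAt, by simp, ?_⟩
    rw [contDiffOn_zero]
    exact hcd.congr fun t ht => (hder t ht).deriv
  · intro t ht
    rw [hu t ht]
    exact memH2_freeResolvent hc (q t)
  · exact fun t ht => (hder t ht).continuousAt.continuousWithinAt
  · intro i
    refine (hqc (fourierMul (partialBCF hc i))).congr fun t ht => ?_
    rw [hu t ht]
    exact weakPartial_freeResolvent hc i (q t)
  · intro i j
    refine (hqc (fourierMul (partialPartialBCF hc i j))).congr fun t ht => ?_
    rw [hu t ht]
    exact weakPartial_weakPartial_freeResolvent hc i j (q t)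
  · intro t ht
    rw [(hder t ht).deriv, hu t ht, weakLaplacian_freeResolvent]
    set a : LC n := l • freeResolvent hc (q t)
    set b : LC n := lpMul (complexBCF V) (freeResolvent hc (q t))
    rw [map_sub, map_sub, map_add]
    filter_upwards [Lp.coeFn_sub (reL a) (reL (q t) + reL b), Lp.coeFn_add (reL (q t)) (reL b),
      Lp.coeFn_sub (reL a) (reL (q t)),
      coeFn_reL_lpMul_complexBCF V (freeResolvent hc (q t))] with x h1 h2 h3 h4
    rw [h1, h3, Pi.sub_apply, Pi.sub_apply, h2, Pi.add_apply, h4]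
    ring

/-- The duality argument: the potential energy of e^{-2tA}u₀ is controlled by ‖e^{-tA}u₀‖²/t through
smoothing, and is then absorbed. -/
theorem norm_heatSolution_le (hc : 1 ≤ c) (hV : ∀ x, 0 < V x)
    (hQ : ∀ f, Q f + lpMul (complexBCF V) (freeResolvent hc (Q f)) = f) {u₀ : L2 n}
    (hu : Integrable (fun x => (u₀ x) ^ 2 / V x) volume) {t : ℝ} (ht : 0 ≤ t) :
    (1 + t) * ‖heatSolution (4 * Real.pi ^ 2 * c ^ 2) (freeResolvent hc ∘L Q) u₀ t‖ ^ 2 ≤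
      ‖u₀‖ ^ 2 + ∫ x, (u₀ x) ^ 2 / V x := by
  set l : ℝ := 4 * Real.pi ^ 2 * c ^ 2
  set J : LC n →L[ℂ] LC n := freeResolvent hc ∘L Q
  have hp := Real.pi_pos
  have hl : 0 < l := by positivity
  have hJ : J.IsPositive := isPositive_freeResolvent_comp hc hV hQ
  have hn : ‖J‖ ≤ l⁻¹ := norm_freeResolvent_comp_le hc hV hQ
  rcases ht.eq_or_lt with rfl | ht
  · rw [heatSolution_zero]
    have : 0 ≤ ∫ x, (u₀ x) ^ 2 / V x :=
      integral_nonneg fun x => div_nonneg (sq_nonneg _) (hV x).le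
    linarith
  set z : LC n := semigroup l J t (toC u₀)
  have hz0 : ‖z‖ ≤ ‖u₀‖ := by
    rw [← norm_toC u₀]
    exact norm_semigroup_apply_le hJ hl hn ht _
  -- A second application of the semigroup: w plays the role of e^{-2tA}u₀, so that pairing it with
  -- u₀ produces ‖z‖².
  set w : LC n := semigroup l J t z
  have hwz : ‖w‖ ≤ ‖z‖ := norm_semigroup_apply_le hJ hl hn ht z
  set p : LC n := semigroupDiv l J t z
  have hwp : w = freeResolvent hc (Q p) := semigroup_apply_eq hJ ht z
  have hzz : (⟪toC u₀, w⟫_ℂ).re = ‖z‖ ^ 2 := by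
    have h1 : ⟪toC u₀, w⟫_ℂ = ⟪z, z⟫_ℂ :=
      (inner_semigroup_symm l J t (toC u₀) z).symm
    rw [h1, inner_self_eq_norm_sq_to_K]
    simp [← Complex.ofReal_pow]
  have hVw : (⟪w, lpMul (complexBCF V) w⟫_ℂ).re ≤ t⁻¹ * ‖z‖ ^ 2 := by
    have h1 := mul_norm_freeResolvent_comp_sq_le hc hQ p
    rw [← hwp] at h1
    -- Here p = (l + A)w, so p - lw is Aw and its pairing with w is the energy.
    have h2 : (⟪p - (l : ℂ) • w, w⟫_ℂ).re = (⟪p, w⟫_ℂ).re - l * ‖w‖ ^ 2 := by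
      rw [inner_sub_left, Complex.sub_re, inner_smul_left,
        inner_self_eq_norm_sq_to_K]
      simp [← Complex.ofReal_pow]
    have h3 : (⟪p - (l : ℂ) • w, w⟫_ℂ).re ≤ ‖p - (l : ℂ) • w‖ * ‖w‖ := re_inner_le_norm (𝕜 := ℂ) _ _
    have h4 : ‖p - (l : ℂ) • w‖ ≤ t⁻¹ * ‖z‖ :=
      norm_semigroupDiv_sub_apply_le hJ hl hn ht z
    calc _ ≤ ‖p - (l : ℂ) • w‖ * ‖w‖ := by linarith
      _ ≤ (t⁻¹ * ‖z‖) * ‖z‖ := by gcongr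
      _ = _ := by ring
  have hdual := two_mul_re_inner_toC_le hV hu w ht
  rw [hzz] at hdual
  have hdecay : t * ‖z‖ ^ 2 ≤ ∫ x, (u₀ x) ^ 2 / V x := by
    have h1 : t * (⟪w, lpMul (complexBCF V) w⟫_ℂ).re ≤ ‖z‖ ^ 2 := by
      have := mul_le_mul_of_nonneg_left hVw ht.le
      rwa [mul_inv_cancel_left₀ ht.ne'] at this
    have h2 : ‖z‖ ^ 2 ≤ t⁻¹ * ∫ x, (u₀ x) ^ 2 / V x := by linarith
    rwa [← div_eq_inv_mul, le_div_iff₀ ht, mul_comm] at h2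
  rw [heatSolution_of_pos ht]
  calc (1 + t) * ‖reL z‖ ^ 2 ≤ (1 + t) * ‖z‖ ^ 2 := by
        gcongr
        exact norm_reL_le z
    _ = ‖z‖ ^ 2 + t * ‖z‖ ^ 2 := by ring
    _ ≤ _ := add_le_add (by gcongr) hdecay

end Schroedinger

end

theorem theorem1p5 :
    ∃ C : ℝ, 0 < C ∧
      ∀ (n : ℕ), 1 ≤ n →
      ∀ (V : EuclideanSpace ℝ (Fin n) →ᵇ ℝ), (∀ x, 0 < V x) →
      ∀ (u₀ : L2 n), Integrable (fun x => (u₀ x) ^ 2 / V x) volume →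
        ∃ u : ℝ → L2 n, IsHeatSolution V u₀ u ∧
          (∀ w : ℝ → L2 n, IsHeatSolution V u₀ w → EqOn w u (Ici 0)) ∧
          ∀ t : ℝ, 0 ≤ t →
            (1 + t) * ‖u t‖ ^ 2 ≤ C * (‖u₀‖ ^ 2 + ∫ x, (u₀ x) ^ 2 / V x) := by
  refine ⟨1, one_pos, fun n _ V hV u₀ hu => ?_⟩
  -- The choice c = 1 + ‖V‖ ensures both c ≥ 1 and 4π²c² > ‖V‖; c does not enter the final estimate.
  have hc : 1 ≤ 1 + ‖V‖ := le_add_of_nonneg_right (norm_nonneg V)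
  have hVc : ‖V‖ < 4 * Real.pi ^ 2 * (1 + ‖V‖) ^ 2 := by
    have h1 : 1 ≤ Real.pi ^ 2 := one_le_pow₀ (by linarith [Real.pi_gt_three])
    nlinarith [norm_nonneg V, sq_nonneg ‖V‖]
  obtain ⟨Q, hQ⟩ := exists_rightInverse_one_add V hc hVc
  have hsol := isHeatSolution_heatSolution hc hV hQ u₀
  refine ⟨_, hsol, fun w hw => hw.eqOn hV hsol, fun t ht => ?_⟩
  rw [one_mul]
  exact norm_heatSolution_le hc hV hQ hu ht
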